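/- Let $M\ge 1$ and $m,l\ge 0$ be integers, let $\alpha_1,\dots,\alpha_M,\beta_1,\dots,\beta_M>0$ be real numbers with $$\sum_{k=1}^M\alpha_k > m+\frac12\left(M+\frac32\right),$$ and let $\lambda$ be a real number with $\lambda\ge\pi\sum_{k=1}^M\beta_k$. Let $J_\nu$ denote the Bessel function of the first kind of order $\nu$, put $$g(x)=\frac{1}{\prod_{k=1}^M\Gamma(\alpha_k+\beta_k x)\,\Gamma(\alpha_k-\beta_k x)}$$ (with the value $0$ at the real points where some gamma factor has a pole), and for $s=0,1,2,\dots$ let $$a_s^{(M)}=\frac{d^{2s}g}{dx^{2s}}(0).$$ Then $x^{2m+1}g(x)J_{2l}(\lambda x)$ is absolutely integrable on $(0,\infty)$. If $l\ge m+1$, then $$\int_0^\infty\frac{x^{2m+1}J_{2l}(\lambda x)}{\prod_{k=1}^M\Gamma(\alpha_k+\beta_k x)\,\Gamma(\alpha_k-\beta_k x)}\,dx=\frac12\sum_{s=0}^{l-m-1}\frac{a_s^{(M)}}{(2s)!}\,\frac{(l+m+s)!}{(l-m-s-1)!}\left(\frac{2}{\lambda}\right)^{2(m+s+1)},$$ and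 if $l<m+1$, then $$\int_0^\infty\frac{x^{2m+1}J_{2l}(\lambda x)}{\prod_{k=1}^M\Gamma(\alpha_k+\beta_k x)\,\Gamma(\alpha_k-\beta_k x)}\,dx=0.$$ -/

import Mathlib

open MeasureTheory Set

noncomputable section

/-- The reciprocal gamma product `1 / ∏ Γ(α k + β k x) Γ(α k - β k x)`.
Since Mathlib's `Real.Gamma` takes the value `0` at its poles and `1 / 0 = 0`, this is the usual
(entire) reciprocal, which vanishes there, for every real `x`. -/
def recipGammaProd {M : ℕ} (α β : Fin M → ℝ) (x : ℝ) : ℝ :=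
  1 / ∏ k, (Real.Gamma (α k + β k * x) * Real.Gamma (α k - β k * x))

/-- The derivative of order `2 s` of the reciprocal gamma product at the origin. -/
def recipGammaCoeff {M : ℕ} (α β : Fin M → ℝ) (s : ℕ) : ℝ :=
  iteratedDeriv (2 * s) (recipGammaProd α β) 0

/-- The terms of the power series of the Bessel function of the first kind of order `n`. -/
def besselJTerm (n : ℕ) (x : ℝ) (k : ℕ) : ℝ :=
  (-1) ^ k / ((Nat.factorial k : ℝ) * (Nat.factorial (k + n) : ℝ)) * (x / 2) ^ (2 * k + n)

/-- The power series of the Bessel function converges absolutely on the whole real line. -/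
theorem summable_besselJTerm (n : ℕ) (x : ℝ) : Summable (besselJTerm n x) := by
  have h := (Real.summable_pow_div_factorial ((x / 2) ^ 2)).mul_left (|x / 2| ^ n)
  refine Summable.of_norm_bounded h fun k => ?_
  have h1 : (0 : ℝ) < (Nat.factorial k : ℝ) := by positivity
  have h2 : (1 : ℝ) ≤ (Nat.factorial (k + n) : ℝ) := by
    exact_mod_cast Nat.factorial_pos (k + n)
  have h3 : ‖besselJTerm n x k‖ =
      |x / 2| ^ n * ((x / 2) ^ 2) ^ k /
        ((Nat.factorial k : ℝ) * (Nat.factorial (k + n) : ℝ)) := by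
    rw [besselJTerm, Real.norm_eq_abs, abs_mul, abs_div, abs_pow, abs_neg, abs_one, one_pow,
      abs_of_pos (by positivity : (0 : ℝ) <
        (Nat.factorial k : ℝ) * (Nat.factorial (k + n) : ℝ)), abs_pow, pow_add, pow_mul, sq_abs]
    ring
  rw [h3, ← mul_div_assoc]
  exact div_le_div_of_nonneg_left (by positivity) h1 (le_mul_of_one_le_right h1.le h2)

/-- The Bessel function of the first kind of integer order `n ≥ 0`,
`J_n(x) = ∑_{k ≥ 0} (-1)^k / (k! (k + n)!) (x / 2)^(2 k + n)`. -/
def besselJ (n : ℕ) (x : ℝ) : ℝ :=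
  ∑' k : ℕ, besselJTerm n x k

end

/-! The integral is a pairing of the moments of a measure with a Laplace transform on the imaginary
axis. By Cauchy's cosine integral, `1 / (Γ(a + x) Γ(a - x))` with `a ≥ 1` is a positive
superposition of `cos (2 x θ)`, `0 ≤ θ ≤ π / 2`. After raising each `α k` by one, the gamma product
is therefore a product of quadratics `α k ^ 2 - β k ^ 2 * x ^ 2` times the Fourier transform `f` of
a finite measure `μ` on `[-π ∑ β, π ∑ β]`.

The Laplace transform of `J_{2l}` is `P(z) (1 + z²)^(-1/2) + Q(z)` up to a real constant in front of
`P`, with `P`, `Q` real polynomials and `P` real on the imaginary axis. The first term is real on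
the segment from `-i` to `i`, so its derivatives of odd order are purely imaginary there. Hence only
`Q` contributes to the real part of the transform of `x^(2n+1) J_{2l}`
(`exists_laplaceInt_pow_mul_besselJ_extension`), and that part is a polynomial in `t` at `z = i t`.
Integrating it against `μ` produces moments of `μ`, that is, Taylor coefficients of `f` at `0`
(`IsBandLimited.hasAbelBesselMoments`).

With the factor `x^(2n+1)` and the quadratics in place, `x^(2n+1) f(x) J_{2l}(x)` need not be
integrable, so these identities are stated for Abel means. They hold for every `n`, which makes them
stable under multiplication by `a - b x²` (`HasAbelBesselMoments.quadratic_mul`). Decay of the gamma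
product and `J_n(x) = O(x^(-1/2))` give integrability of the actual integrand, so Abel means become
integrals. Scaling by `λ` covers `λ > π ∑ β`; the endpoint follows by dominated convergence. -/

open Filter Topology

/-! ### Bessel functions of integer order -/

/-- The entire function `c_n` with `J_n(x) = (x / 2) ^ n * c_n (x ^ 2 / 4)`. -/
noncomputable def besselClifford (n : ℕ) (y : ℝ) : ℝ :=
  ∑' k : ℕ, (-1) ^ k / ((Nat.factorial k : ℝ) * (Nat.factorial (k + n) : ℝ)) * y ^ k

lemma norm_besselClifford_coeff (n k : ℕ) :
    ‖(-1 : ℝ) ^ k / ((Nat.factorial k : ℝ) * (Nat.factorial (k + n) : ℝ))‖ =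
      1 / ((Nat.factorial k : ℝ) * (Nat.factorial (k + n) : ℝ)) := by
  rw [Real.norm_eq_abs, abs_div, abs_pow, abs_neg, abs_one, one_pow,
    abs_of_pos (by positivity)]

lemma norm_besselClifford_term_le (n k : ℕ) (y : ℝ) :
    ‖(-1) ^ k / ((Nat.factorial k : ℝ) * (Nat.factorial (k + n) : ℝ)) * y ^ k‖ ≤
      |y| ^ k / (Nat.factorial k : ℝ) := by
  have h1 : (0 : ℝ) < (Nat.factorial k : ℝ) := by positivity
  have h2 : (1 : ℝ) ≤ (Nat.factorial (k + n) : ℝ) := by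
    exact_mod_cast Nat.factorial_pos (k + n)
  rw [norm_mul, norm_besselClifford_coeff, norm_pow, Real.norm_eq_abs, div_mul_eq_mul_div, one_mul]
  exact div_le_div_of_nonneg_left (by positivity) h1 (le_mul_of_one_le_right h1.le h2)

lemma summable_besselClifford (n : ℕ) (y : ℝ) :
    Summable fun k : ℕ =>
      (-1) ^ k / ((Nat.factorial k : ℝ) * (Nat.factorial (k + n) : ℝ)) * y ^ k :=
  Summable.of_norm_bounded (Real.summable_pow_div_factorial |y|)
    fun k => norm_besselClifford_term_le n k y

lemma besselJ_eq_besselClifford (n : ℕ) (x : ℝ) :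
    besselJ n x = (x / 2) ^ n * besselClifford n ((x / 2) ^ 2) := by
  rw [besselJ, besselClifford, ← tsum_mul_left]
  congr 1; ext k
  rw [besselJTerm, pow_add, pow_mul]; ring

lemma hasDerivAt_besselClifford (n : ℕ) (y : ℝ) :
    HasDerivAt (besselClifford n) (-besselClifford (n + 1) y) y := by
  set R : ℝ := |y| + 1 with hR
  have hR0 : 0 ≤ R := by positivity
  have key := hasDerivAt_tsum_of_isPreconnected (𝕜 := ℝ)
    (u := fun k : ℕ => (k : ℝ) * (R ^ (k - 1) / (Nat.factorial k : ℝ)))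
    (g := fun (k : ℕ) (y : ℝ) =>
      (-1) ^ k / ((Nat.factorial k : ℝ) * (Nat.factorial (k + n) : ℝ)) * y ^ k)
    (g' := fun (k : ℕ) (y : ℝ) =>
      (-1) ^ k / ((Nat.factorial k : ℝ) * (Nat.factorial (k + n) : ℝ)) * (k * y ^ (k - 1)))
    (t := Metric.ball 0 R) (y₀ := 0) (y := y) ?_ Metric.isOpen_ball
    (convex_ball (0 : ℝ) R).isPreconnected ?_ ?_ (Metric.mem_ball_self (by positivity))
    (summable_besselClifford n 0) (by simp [hR])
  · refine key.congr_deriv ?_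
    rw [Summable.tsum_eq_zero_add]
    · simp only [Nat.cast_zero, zero_mul, mul_zero, zero_add, Nat.add_sub_cancel]
      rw [besselClifford, ← tsum_neg]
      congr 1; ext k
      have h1 : ((k + 1).factorial : ℝ) = (k + 1) * k.factorial := by
        rw [Nat.factorial_succ]; push_cast; ring
      rw [show k + 1 + n = k + (n + 1) by ring, h1]
      have h2 : (k.factorial : ℝ) ≠ 0 := by positivity
      have h3 : ((k + (n + 1)).factorial : ℝ) ≠ 0 := by positivity
      have h4 : (k : ℝ) + 1 ≠ 0 := by positivity
      push_cast
      field_simp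
      ring
    · rw [← summable_nat_add_iff 1]
      refine ((summable_besselClifford (n + 1) y).neg).congr fun k => ?_
      have h1 : ((k + 1).factorial : ℝ) = (k + 1) * k.factorial := by
        rw [Nat.factorial_succ]; push_cast; ring
      rw [show k + 1 + n = k + (n + 1) by ring, h1]
      have h2 : (k.factorial : ℝ) ≠ 0 := by positivity
      have h3 : ((k + (n + 1)).factorial : ℝ) ≠ 0 := by positivity
      have h4 : (k : ℝ) + 1 ≠ 0 := by positivity
      rw [Nat.add_sub_cancel]
      push_cast
      field_simp
      ring
  · rw [← summable_nat_add_iff 1]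
    refine (Real.summable_pow_div_factorial R).congr fun k => ?_
    have h1 : ((k + 1).factorial : ℝ) = (k + 1) * k.factorial := by
      rw [Nat.factorial_succ]; push_cast; ring
    have h2 : (k.factorial : ℝ) ≠ 0 := by positivity
    have h4 : (k : ℝ) + 1 ≠ 0 := by positivity
    rw [h1, Nat.add_sub_cancel]; push_cast
    field_simp
  · intro k z _
    exact (hasDerivAt_pow k z).const_mul _
  · intro k z hz
    have hz' : |z| ≤ R := by simpa using (mem_ball_zero_iff.1 hz).le
    have h1 : (0 : ℝ) < (Nat.factorial k : ℝ) := by positivity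
    have h2 : (1 : ℝ) ≤ (Nat.factorial (k + n) : ℝ) := by
      exact_mod_cast Nat.factorial_pos (k + n)
    have e : ‖(-1) ^ k / ((Nat.factorial k : ℝ) * (Nat.factorial (k + n) : ℝ)) *
        (k * z ^ (k - 1))‖ =
        k * (|z| ^ (k - 1) / ((Nat.factorial k : ℝ) * (Nat.factorial (k + n) : ℝ))) := by
      rw [norm_mul, norm_besselClifford_coeff, norm_mul, norm_pow, Real.norm_natCast,
        Real.norm_eq_abs]
      ring
    rw [e]
    gcongr
    exact le_mul_of_one_le_right h1.le h2

/-- Coefficients of equal powers of `y` agree. This is the three-term Bessel recurrence freed of any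
division by `x`, so it also serves at the origin. -/
lemma besselClifford_recurrence (n : ℕ) (y : ℝ) :
    besselClifford n y + y * besselClifford (n + 2) y = (n + 1) * besselClifford (n + 1) y := by
  rw [besselClifford, besselClifford, besselClifford, ← tsum_mul_left, ← tsum_mul_left,
    (summable_besselClifford n y).tsum_eq_zero_add,
    ((summable_besselClifford (n + 1) y).mul_left _).tsum_eq_zero_add, add_assoc,
    ← Summable.tsum_add]
  · congr 1
    · simp only [pow_zero, zero_add, mul_one, Nat.factorial_zero, Nat.factorial_succ]
      push_cast
      have h2 : (n.factorial : ℝ) ≠ 0 := by positivity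
      have h4 : (n : ℝ) + 1 ≠ 0 := by positivity
      field_simp
    · congr 1; ext k
      rw [show k + (n + 2) = k + n + 1 + 1 by ring, show k + 1 + (n + 1) = k + n + 1 + 1 by ring,
        show k + 1 + n = k + n + 1 by ring, Nat.factorial_succ (k + n + 1),
        Nat.factorial_succ k]
      have h2 : (k.factorial : ℝ) ≠ 0 := by positivity
      have h3 : ((k + n + 1).factorial : ℝ) ≠ 0 := by positivity
      have h4 : (k : ℝ) + 1 ≠ 0 := by positivity
      have h5 : (k : ℝ) + n + 1 + 1 ≠ 0 := by positivity
      push_cast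
      field_simp
      ring
  · exact (summable_nat_add_iff 1).2 (summable_besselClifford n y)
  · exact (summable_besselClifford (n + 2) y).mul_left _

lemma besselJ_recurrence (n : ℕ) (x : ℝ) :
    2 * (n + 1) * besselJ (n + 1) x = x * (besselJ n x + besselJ (n + 2) x) := by
  have h := besselClifford_recurrence n ((x / 2) ^ 2)
  simp only [besselJ_eq_besselClifford]
  calc _ = 2 * (x / 2) ^ (n + 1) * ((n + 1) * besselClifford (n + 1) ((x / 2) ^ 2)) := by ring
    _ = _ := by rw [← h]; ring

lemma hasDerivAt_besselClifford_comp (n : ℕ) (x : ℝ) :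
    HasDerivAt (fun x : ℝ => besselClifford n ((x / 2) ^ 2))
      (-(x / 2) * besselClifford (n + 1) ((x / 2) ^ 2)) x := by
  have h : HasDerivAt (fun x : ℝ => (x / 2) ^ 2) (x / 2) x := by
    refine (((hasDerivAt_id x).div_const 2).pow 2).congr_deriv ?_
    simp; ring
  refine ((hasDerivAt_besselClifford n _).comp x h).congr_deriv ?_
  ring

lemma hasDerivAt_besselJ_zero (x : ℝ) : HasDerivAt (besselJ 0) (-besselJ 1 x) x := by
  have e : besselJ 0 = fun x : ℝ => besselClifford 0 ((x / 2) ^ 2) := by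
    ext x; rw [besselJ_eq_besselClifford]; simp
  rw [e]
  refine (hasDerivAt_besselClifford_comp 0 x).congr_deriv ?_
  rw [besselJ_eq_besselClifford]; ring_nf

lemma hasDerivAt_besselJ_succ (n : ℕ) (x : ℝ) :
    HasDerivAt (besselJ (n + 1)) ((besselJ n x - besselJ (n + 2) x) / 2) x := by
  have e : besselJ (n + 1) = fun x : ℝ => (x / 2) ^ (n + 1) *
      besselClifford (n + 1) ((x / 2) ^ 2) := by
    ext x; rw [besselJ_eq_besselClifford]
  rw [e]
  refine ((((hasDerivAt_id x).div_const 2).pow (n + 1)).mul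
    (hasDerivAt_besselClifford_comp (n + 1) x)).congr_deriv ?_
  have h := besselClifford_recurrence n ((x / 2) ^ 2)
  simp only [besselJ_eq_besselClifford, Nat.add_sub_cancel, id]
  push_cast
  calc _ = (x / 2) ^ n / 2 * (((n : ℝ) + 1) * besselClifford (n + 1) ((x / 2) ^ 2)) -
        (x / 2) ^ (n + 2) * besselClifford (n + 2) ((x / 2) ^ 2) := by
        simp only [Pi.pow_apply]; ring
    _ = _ := by rw [← h]; ring

lemma continuous_besselJ (n : ℕ) : Continuous (besselJ n) := by
  cases n with
  | zero => exact continuous_iff_continuousAt.2 fun x => (hasDerivAt_besselJ_zero x).continuousAt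
  | succ n => exact continuous_iff_continuousAt.2 fun x => (hasDerivAt_besselJ_succ n x).continuousAt

lemma besselJ_zero_zero : besselJ 0 0 = 1 := by
  rw [besselJ_eq_besselClifford, besselClifford, tsum_eq_single 0]
  · simp
  · intro k hk; simp [hk]

lemma besselJ_succ_zero (n : ℕ) : besselJ (n + 1) 0 = 0 := by
  rw [besselJ_eq_besselClifford]; simp

lemma hasDerivAt_besselJ_one (x : ℝ) (hx : x ≠ 0) :
    HasDerivAt (besselJ 1) (besselJ 0 x - besselJ 1 x / x) x := by
  refine (hasDerivAt_besselJ_succ 0 x).congr_deriv ?_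
  have h := besselJ_recurrence 0 x
  simp only [zero_add, Nat.cast_zero, mul_one] at h ⊢
  field_simp
  linarith

/-! ### Decay of Bessel functions on the half-line -/

/-- The energy estimate `x (J_0 ^ 2 + J_1 ^ 2) = O(1)`. -/
lemma exists_mul_besselJ_sq_add_sq_le :
    ∃ C : ℝ, ∀ x : ℝ, 1 ≤ x → x * (besselJ 0 x ^ 2 + besselJ 1 x ^ 2) ≤ C := by
  -- Subtracting `J_0 J_1` from the energy leaves the derivative `J_0 J_1 / x`, which is bounded by
  -- the energy over `x²`; the factor `exp (1 / x)` absorbs it and makes `W` decreasing.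
  set W : ℝ → ℝ := fun x =>
    (x * (besselJ 0 x ^ 2 + besselJ 1 x ^ 2) - besselJ 0 x * besselJ 1 x) * Real.exp (1 / x) with hW
  have hd : ∀ x : ℝ, 0 < x → HasDerivAt W
      ((besselJ 0 x * besselJ 1 x / x - (x * (besselJ 0 x ^ 2 + besselJ 1 x ^ 2) -
        besselJ 0 x * besselJ 1 x) / x ^ 2) * Real.exp (1 / x)) x := by
    intro x hx
    have h0 := hasDerivAt_besselJ_zero x
    have h1 := hasDerivAt_besselJ_one x hx.ne'
    have he : HasDerivAt (fun x : ℝ => Real.exp (1 / x)) (Real.exp (1 / x) * (-1 / x ^ 2)) x := by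
      have : HasDerivAt (fun x : ℝ => 1 / x) (-1 / x ^ 2) x := by
        simpa [one_div] using (hasDerivAt_inv hx.ne').congr_deriv (by ring)
      exact this.exp
    refine ((((hasDerivAt_id x).mul ((h0.pow 2).add (h1.pow 2))).sub (h0.mul h1)).mul
      he).congr_deriv ?_
    simp only [Pi.add_apply, Pi.pow_apply, Pi.mul_apply, Pi.sub_apply, id]
    field_simp
    ring
  have hanti : AntitoneOn W (Ici 1) := by
    refine antitoneOn_of_deriv_nonpos (convex_Ici 1) (fun x hx =>
      (hd x (lt_of_lt_of_le one_pos hx)).continuousAt.continuousWithinAt) (fun x hx => ?_) ?_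
    · rw [interior_Ici] at hx
      exact (hd x (one_pos.trans hx)).differentiableAt.differentiableWithinAt
    · intro x hx
      rw [interior_Ici] at hx
      have hx1 : (1 : ℝ) < x := hx
      have hx0 : (0 : ℝ) < x := one_pos.trans hx
      rw [(hd x hx0).deriv]
      refine mul_nonpos_of_nonpos_of_nonneg ?_ (Real.exp_pos _).le
      have : besselJ 0 x * besselJ 1 x / x - (x * (besselJ 0 x ^ 2 + besselJ 1 x ^ 2) -
        besselJ 0 x * besselJ 1 x) / x ^ 2 =
        -(x * (besselJ 0 x ^ 2 + besselJ 1 x ^ 2) - (x + 1) * (besselJ 0 x * besselJ 1 x))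
          / x ^ 2 := by
        field_simp; ring
      rw [this]
      refine div_nonpos_of_nonpos_of_nonneg ?_ (by positivity)
      -- `|J_0 J_1| ≤ (J_0² + J_1²) / 2` and `(x + 1) / 2 ≤ x` for `x ≥ 1`.
      nlinarith [sq_nonneg (besselJ 0 x - besselJ 1 x), sq_nonneg (besselJ 0 x + besselJ 1 x)]
  refine ⟨2 * W 1, fun x hx => ?_⟩
  have h1 := hanti (self_mem_Ici) hx hx
  have hx0 : (0 : ℝ) < x := one_pos.trans_le hx
  set E := x * (besselJ 0 x ^ 2 + besselJ 1 x ^ 2) with hE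
  have h2 : E / 2 ≤ E - besselJ 0 x * besselJ 1 x := by
    nlinarith [sq_nonneg (besselJ 0 x - besselJ 1 x), sq_nonneg (besselJ 0 x + besselJ 1 x),
      mul_nonneg (sub_nonneg.2 hx) (add_nonneg (sq_nonneg (besselJ 0 x)) (sq_nonneg (besselJ 1 x)))]
  have hE0 : 0 ≤ E := by positivity
  have h3 : E - besselJ 0 x * besselJ 1 x ≤ W x :=
    le_mul_of_one_le_right (by linarith) (Real.one_le_exp (by positivity))
  linarith

/-- The energy estimate settles orders `0` and `1`; the upward recurrence, whose factor `2 (n + 1) /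
x` is bounded for `x ≥ 1`, preserves the rate. -/
lemma exists_sqrt_mul_abs_besselJ_le (n : ℕ) :
    ∃ C : ℝ, ∀ x : ℝ, 1 ≤ x → √x * |besselJ n x| ≤ C := by
  obtain ⟨C, hC⟩ := exists_mul_besselJ_sq_add_sq_le
  have aux : ∀ x a : ℝ, 1 ≤ x → x * a ^ 2 ≤ C → √x * |a| ≤ √C := by
    intro x a hx h
    rw [← Real.sqrt_sq_eq_abs, ← Real.sqrt_mul (by linarith)]
    exact Real.sqrt_le_sqrt h
  induction n using Nat.strong_induction_on with
  | _ n ih =>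
    match n, ih with
    | 0, _ =>
      refine ⟨√C, fun x hx => aux x _ hx ((hC x hx).trans' ?_)⟩
      gcongr; linarith [sq_nonneg (besselJ 1 x)]
    | 1, _ =>
      refine ⟨√C, fun x hx => aux x _ hx ((hC x hx).trans' ?_)⟩
      gcongr; linarith [sq_nonneg (besselJ 0 x)]
    | n + 2, ih =>
      obtain ⟨A, hA⟩ := ih n (by omega)
      obtain ⟨B, hB⟩ := ih (n + 1) (by omega)
      refine ⟨2 * (n + 1) * B + A, fun x hx => ?_⟩
      have h := besselJ_recurrence n x
      have hx0 : (0 : ℝ) < x := by linarith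
      have e : besselJ (n + 2) x = 2 * (n + 1) / x * besselJ (n + 1) x - besselJ n x := by
        field_simp; linarith
      have h1 : |besselJ (n + 2) x| ≤ 2 * (n + 1) * |besselJ (n + 1) x| + |besselJ n x| := by
        rw [e]
        refine (abs_sub _ _).trans ?_
        rw [abs_mul, abs_of_nonneg (by positivity : (0 : ℝ) ≤ 2 * (n + 1) / x)]
        gcongr
        exact div_le_self (by positivity) hx
      calc √x * |besselJ (n + 2) x| ≤ √x * (2 * (n + 1) * |besselJ (n + 1) x| + |besselJ n x|) := by
            gcongr
        _ = 2 * (n + 1) * (√x * |besselJ (n + 1) x|) + √x * |besselJ n x| := by ring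
        _ ≤ _ := by gcongr; exacts [hB x hx, hA x hx]

lemma exists_abs_besselJ_le (n : ℕ) :
    ∃ C : ℝ, 0 < C ∧ ∀ x : ℝ, 0 ≤ x → |besselJ n x| ≤ C * (1 + x) ^ (-(1 / 2) : ℝ) := by
  obtain ⟨A, hA⟩ := exists_sqrt_mul_abs_besselJ_le n
  obtain ⟨B, hB⟩ := (isCompact_Icc (a := (0 : ℝ)) (b := 1)).exists_bound_of_continuousOn
    (continuous_besselJ n).continuousOn
  refine ⟨2 * (|A| + |B| + 1), by positivity, fun x hx => ?_⟩
  rw [Real.rpow_neg (by linarith), ← Real.sqrt_eq_rpow, ← div_eq_mul_inv,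
    le_div_iff₀ (Real.sqrt_pos.2 (by linarith))]
  rcases le_total x 1 with h | h
  · have h1 : √(1 + x) ≤ 2 := by rw [Real.sqrt_le_left (by norm_num)]; linarith
    have h2 : |besselJ n x| ≤ |B| := (hB x ⟨hx, h⟩).trans (le_abs_self B)
    calc |besselJ n x| * √(1 + x) ≤ |B| * 2 := by gcongr
      _ ≤ _ := by nlinarith [abs_nonneg A]
  · have h1 : √(1 + x) ≤ 2 * √x := by
      rw [show (2 : ℝ) = √4 by rw [show (4 : ℝ) = 2 ^ 2 by norm_num]; simp,
        ← Real.sqrt_mul (by norm_num)]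
      exact Real.sqrt_le_sqrt (by linarith)
    calc |besselJ n x| * √(1 + x) ≤ |besselJ n x| * (2 * √x) := by gcongr
      _ = 2 * (√x * |besselJ n x|) := by ring
      _ ≤ 2 * |A| := by gcongr; exact (hA x h).trans (le_abs_self A)
      _ ≤ _ := by linarith [abs_nonneg B]

lemma exists_abs_besselJ_le_const (n : ℕ) :
    ∃ C : ℝ, 0 < C ∧ ∀ x : ℝ, 0 ≤ x → |besselJ n x| ≤ C := by
  obtain ⟨C, hC, h⟩ := exists_abs_besselJ_le n
  refine ⟨C, hC, fun x hx => (h x hx).trans ?_⟩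
  exact mul_le_of_le_one_right hC.le (Real.rpow_le_one_of_one_le_of_nonpos (by linarith) (by norm_num))

/-! ### Laplace transforms of functions of polynomial growth -/

/-- Continuous functions on the line of at most polynomial growth on `[0, ∞)`. -/
def PolyGrowth (f : ℝ → ℝ) : Prop :=
  Continuous f ∧ ∃ (C : ℝ) (N : ℕ), ∀ x : ℝ, 0 ≤ x → |f x| ≤ C * (1 + x) ^ N

/-- The Laplace transform `z ↦ ∫_0^∞ e^{-z x} f(x) dx`. -/
noncomputable def laplaceInt (f : ℝ → ℝ) (z : ℂ) : ℂ :=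
  ∫ x in Ioi (0 : ℝ), Complex.exp (-(z * x)) * f x

lemma PolyGrowth.mul {f g : ℝ → ℝ} (hf : PolyGrowth f) (hg : PolyGrowth g) :
    PolyGrowth fun x => f x * g x := by
  obtain ⟨hfc, C, N, hC⟩ := hf
  obtain ⟨hgc, D, K, hD⟩ := hg
  refine ⟨hfc.mul hgc, C * D, N + K, fun x hx => ?_⟩
  rw [abs_mul, pow_add]
  calc |f x| * |g x| ≤ (C * (1 + x) ^ N) * (D * (1 + x) ^ K) :=
        mul_le_mul (hC x hx) (hD x hx) (abs_nonneg _) ((abs_nonneg _).trans (hC x hx))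
    _ = _ := by ring

lemma polyGrowth_const (c : ℝ) : PolyGrowth fun _ => c :=
  ⟨continuous_const, |c|, 0, by simp⟩

lemma polyGrowth_pow (k : ℕ) : PolyGrowth fun x => x ^ k := by
  refine ⟨continuous_pow k, 1, k, fun x hx => ?_⟩
  rw [abs_pow, abs_of_nonneg hx, one_mul]
  gcongr; linarith

lemma polyGrowth_besselJ (n : ℕ) : PolyGrowth (besselJ n) := by
  obtain ⟨C, -, h⟩ := exists_abs_besselJ_le_const n
  exact ⟨continuous_besselJ n, C, 0, by simpa using h⟩

lemma isLittleO_one_add_pow_mul_exp_neg (N : ℕ) {r : ℝ} (hr : 0 < r) :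
    (fun x : ℝ => (1 + x) ^ N * Real.exp (-r * x)) =o[atTop] fun x => Real.exp (-(r / 2) * x) := by
  have h1 : (fun x : ℝ => (1 + x) ^ N) =o[atTop] fun x => Real.exp (r / 2 * x) := by
    refine Asymptotics.IsBigO.trans_isLittleO (g := fun x : ℝ => x ^ N) ?_
      (isLittleO_pow_exp_pos_mul_atTop N (by positivity))
    refine Asymptotics.IsBigO.pow ?_ N
    refine Asymptotics.IsBigO.of_bound 2 ?_
    filter_upwards [eventually_ge_atTop 1] with x hx
    rw [Real.norm_of_nonneg (by linarith), Real.norm_of_nonneg (by linarith)]; linarith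
  refine (h1.mul_isBigO (Asymptotics.isBigO_refl (fun x : ℝ => Real.exp (-r * x)) atTop)).congr_right
    fun x => ?_
  rw [← Real.exp_add]; ring_nf

lemma integrableOn_one_add_pow_mul_exp_neg (N : ℕ) {r : ℝ} (hr : 0 < r) :
    IntegrableOn (fun x : ℝ => (1 + x) ^ N * Real.exp (-r * x)) (Ioi 0) :=
  integrable_of_isBigO_exp_neg (b := r / 2) (by positivity) (by fun_prop)
    (isLittleO_one_add_pow_mul_exp_neg N hr).isBigO

lemma tendsto_one_add_pow_mul_exp_neg (N : ℕ) {r : ℝ} (hr : 0 < r) :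
    Tendsto (fun x : ℝ => (1 + x) ^ N * Real.exp (-r * x)) atTop (𝓝 0) := by
  refine (isLittleO_one_add_pow_mul_exp_neg N hr).isBigO.trans_tendsto ?_
  have : Tendsto (fun x : ℝ => -(r / 2) * x) atTop atBot :=
    tendsto_id.const_mul_atTop_of_neg (by linarith)
  exact Real.tendsto_exp_atBot.comp this

lemma norm_exp_neg_mul_ofReal (z : ℂ) (x : ℝ) :
    ‖Complex.exp (-(z * x))‖ = Real.exp (-z.re * x) := by
  rw [Complex.norm_exp]; simp

lemma PolyGrowth.integrableOn_laplace {f : ℝ → ℝ} (hf : PolyGrowth f) {z : ℂ} (hz : 0 < z.re) :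
    IntegrableOn (fun x : ℝ => Complex.exp (-(z * x)) * f x) (Ioi 0) := by
  obtain ⟨hfc, C, N, hC⟩ := hf
  refine Integrable.mono' ((integrableOn_one_add_pow_mul_exp_neg N hz).const_mul C)
    (by fun_prop) ?_
  filter_upwards [ae_restrict_mem measurableSet_Ioi] with x hx
  rw [norm_mul, norm_exp_neg_mul_ofReal, Complex.norm_real]
  calc _ ≤ Real.exp (-z.re * x) * (C * (1 + x) ^ N) := by gcongr; exact hC x (le_of_lt hx)
    _ = _ := by ring

lemma PolyGrowth.hasDerivAt_laplaceInt {f : ℝ → ℝ} (hf : PolyGrowth f) {z : ℂ} (hz : 0 < z.re) :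
    HasDerivAt (laplaceInt f) (-laplaceInt (fun x => x * f x) z) z := by
  have hxf : PolyGrowth fun x => x * f x := by simpa using (polyGrowth_pow 1).mul hf
  obtain ⟨hfc, C, N, hC⟩ := id hxf
  have hfc' := hf.1
  have hs : {w : ℂ | z.re / 2 < w.re} ∈ 𝓝 z :=
    (isOpen_lt continuous_const Complex.continuous_re).mem_nhds
      (by simp only [mem_ofPred_eq]; linarith)
  have key := hasDerivAt_integral_of_dominated_loc_of_deriv_le
    (μ := volume.restrict (Ioi (0 : ℝ))) (F := fun (w : ℂ) (x : ℝ) => Complex.exp (-(w * x)) * f x)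
    (F' := fun (w : ℂ) (x : ℝ) => -(Complex.exp (-(w * x)) * ((x * f x : ℝ) : ℂ)))
    (bound := fun x => C * ((1 + x) ^ N * Real.exp (-(z.re / 2) * x))) hs
    (Eventually.of_forall fun w => by fun_prop) (hf.integrableOn_laplace hz)
    (by fun_prop) ?_ ((integrableOn_one_add_pow_mul_exp_neg N (half_pos hz)).const_mul C) ?_
  · refine key.2.congr_deriv ?_
    rw [laplaceInt, integral_neg]
  · filter_upwards [ae_restrict_mem measurableSet_Ioi] with x hx w hw
    have hx' : (0 : ℝ) < x := hx
    have hw' : z.re / 2 < w.re := hw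
    rw [norm_neg, norm_mul, norm_exp_neg_mul_ofReal, Complex.norm_real]
    calc _ ≤ Real.exp (-(z.re / 2) * x) * (C * (1 + x) ^ N) := by
          gcongr; exact hC x hx'.le
      _ = _ := by ring
  · filter_upwards with x w _
    have h1 : HasDerivAt (fun w : ℂ => -(w * x)) (-(x : ℂ)) w := by
      simpa using ((hasDerivAt_id w).mul_const (x : ℂ)).fun_neg
    refine (h1.cexp.mul_const (f x : ℂ)).congr_deriv ?_
    push_cast; ring

lemma PolyGrowth.iteratedDeriv_laplaceInt {f : ℝ → ℝ} (hf : PolyGrowth f) (k : ℕ) {z : ℂ}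
    (hz : 0 < z.re) :
    iteratedDeriv k (laplaceInt f) z = (-1) ^ k * laplaceInt (fun x => x ^ k * f x) z := by
  induction k generalizing z with
  | zero => simp
  | succ k ih =>
    rw [iteratedDeriv_succ]
    have h : iteratedDeriv k (laplaceInt f) =ᶠ[𝓝 z]
        fun z => (-1) ^ k * laplaceInt (fun x => x ^ k * f x) z := by
      filter_upwards [(isOpen_lt continuous_const Complex.continuous_re).mem_nhds hz] with w hw
      exact ih hw
    rw [h.deriv_eq, ((((polyGrowth_pow k).mul hf).hasDerivAt_laplaceInt hz).const_mul _).deriv]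
    have : (fun x : ℝ => x * (x ^ k * f x)) = fun x => x ^ (k + 1) * f x := by ext x; ring
    rw [this]; ring

/-- The function `e^{-zx} f(x)` tends to `0` at infinity, so its derivative integrates to `-f 0`. -/
lemma laplaceInt_deriv {f f' : ℝ → ℝ} (hf : PolyGrowth f) (hf' : PolyGrowth f')
    (hd : ∀ x, HasDerivAt f (f' x) x) {z : ℂ} (hz : 0 < z.re) :
    laplaceInt f' z = z * laplaceInt f z - f 0 := by
  have hF : ∀ x ∈ Ici (0 : ℝ), HasDerivAt (fun x : ℝ => Complex.exp (-(z * x)) * f x)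
      (Complex.exp (-(z * x)) * f' x - z * (Complex.exp (-(z * x)) * f x)) x := by
    intro x _
    have h1 : HasDerivAt (fun x : ℝ => -(z * (x : ℂ))) (-z) x := by
      simpa using ((hasDerivAt_id x).ofReal_comp.const_mul z).fun_neg
    refine (h1.cexp.mul (hd x).ofReal_comp).congr_deriv ?_
    ring
  have hi1 := hf'.integrableOn_laplace hz
  have hi2 := (hf.integrableOn_laplace hz).const_mul z
  have h0 : Tendsto (fun x : ℝ => Complex.exp (-(z * x)) * f x) atTop (𝓝 0) := by
    obtain ⟨hfc, C, N, hC⟩ := hf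
    have h := (tendsto_one_add_pow_mul_exp_neg N hz).const_mul C
    rw [mul_zero] at h
    refine squeeze_zero_norm' ?_ h
    filter_upwards [eventually_ge_atTop 0] with x hx
    rw [norm_mul, norm_exp_neg_mul_ofReal, Complex.norm_real]
    calc _ ≤ Real.exp (-z.re * x) * (C * (1 + x) ^ N) := by gcongr; exact hC x hx
      _ = _ := by ring
  have := integral_Ioi_of_hasDerivAt_of_tendsto' hF (hi1.sub hi2) h0
  rw [integral_sub hi1 hi2, integral_const_mul] at this
  simp only [Complex.ofReal_zero, mul_zero, neg_zero, Complex.exp_zero, one_mul, zero_sub] at this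
  rw [laplaceInt, laplaceInt]
  linear_combination this

/-! ### Laplace transforms of Bessel functions -/

lemma laplaceInt_besselJ_one {z : ℂ} (hz : 0 < z.re) :
    laplaceInt (besselJ 1) z = 1 - z * laplaceInt (besselJ 0) z := by
  have hn : PolyGrowth fun x => -besselJ 1 x := by
    simpa using (polyGrowth_const (-1)).mul (polyGrowth_besselJ 1)
  have h := laplaceInt_deriv (polyGrowth_besselJ 0) hn hasDerivAt_besselJ_zero hz
  rw [besselJ_zero_zero] at h
  have e : laplaceInt (fun x => -besselJ 1 x) z = -laplaceInt (besselJ 1) z := by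
    rw [laplaceInt, laplaceInt, ← integral_neg]; simp
  rw [e] at h
  push_cast at h
  linear_combination -h

lemma PolyGrowth.sub {f g : ℝ → ℝ} (hf : PolyGrowth f) (hg : PolyGrowth g) :
    PolyGrowth fun x => f x - g x := by
  obtain ⟨hfc, C, N, hC⟩ := hf
  obtain ⟨hgc, D, K, hD⟩ := hg
  refine ⟨hfc.sub hgc, |C| + |D|, N + K, fun x hx => ?_⟩
  have h1 : (1 + x) ^ N ≤ (1 + x) ^ (N + K) := pow_le_pow_right₀ (by linarith) (by omega)
  have h2 : (1 + x) ^ K ≤ (1 + x) ^ (N + K) := pow_le_pow_right₀ (by linarith) (by omega)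
  calc |f x - g x| ≤ |f x| + |g x| := abs_sub _ _
    _ ≤ |C| * (1 + x) ^ N + |D| * (1 + x) ^ K := by
        gcongr
        · exact (hC x hx).trans (by gcongr; exact le_abs_self C)
        · exact (hD x hx).trans (by gcongr; exact le_abs_self D)
    _ ≤ |C| * (1 + x) ^ (N + K) + |D| * (1 + x) ^ (N + K) := by gcongr
    _ = _ := by ring

lemma laplaceInt_besselJ_add_two (n : ℕ) {z : ℂ} (hz : 0 < z.re) :
    laplaceInt (besselJ (n + 2)) z =
      laplaceInt (besselJ n) z - 2 * z * laplaceInt (besselJ (n + 1)) z := by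
  have hn : PolyGrowth fun x => (besselJ n x - besselJ (n + 2) x) / 2 := by
    have := ((polyGrowth_const (1 / 2)).mul
      ((polyGrowth_besselJ n).sub (polyGrowth_besselJ (n + 2))))
    convert this using 2
    ring
  have h := laplaceInt_deriv (polyGrowth_besselJ (n + 1)) hn (hasDerivAt_besselJ_succ n) hz
  rw [besselJ_succ_zero] at h
  have e : laplaceInt (fun x => (besselJ n x - besselJ (n + 2) x) / 2) z =
      (laplaceInt (besselJ n) z - laplaceInt (besselJ (n + 2)) z) / 2 := by
    rw [laplaceInt, laplaceInt, laplaceInt, ← integral_sub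
      ((polyGrowth_besselJ n).integrableOn_laplace hz)
      ((polyGrowth_besselJ (n + 2)).integrableOn_laplace hz), ← integral_div]
    congr 1; ext x; push_cast; ring
  rw [e] at h
  push_cast at h
  linear_combination -2 * h

/-- The differential equation of the Laplace transform of `J_0`. -/
lemma hasDerivAt_laplaceInt_besselJ_zero {z : ℂ} (hz : 0 < z.re) :
    ∃ d : ℂ, HasDerivAt (laplaceInt (besselJ 0)) d z ∧
      (1 + z ^ 2) * d + z * laplaceInt (besselJ 0) z = 0 := by
  have h0 := (polyGrowth_besselJ 0).hasDerivAt_laplaceInt hz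
  have h1 := (polyGrowth_besselJ 1).hasDerivAt_laplaceInt hz
  refine ⟨_, h0, ?_⟩
  have hev : laplaceInt (besselJ 1) =ᶠ[𝓝 z] fun z => 1 - z * laplaceInt (besselJ 0) z := by
    filter_upwards [(isOpen_lt continuous_const Complex.continuous_re).mem_nhds hz] with w hw
    exact laplaceInt_besselJ_one hw
  -- Two evaluations of the transform of `x J_1` are compared: by differentiating that of `J_1` in
  -- `z`, and by `(x J_1)' = x J_0`.
  have h2 := (h1.congr_of_eventuallyEq hev.symm).unique
    (((hasDerivAt_id z).mul h0).const_sub 1)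
  have p0 : PolyGrowth fun x => x * besselJ 0 x := by
    simpa using (polyGrowth_pow 1).mul (polyGrowth_besselJ 0)
  have p1 : PolyGrowth fun x => x * besselJ 1 x := by
    simpa using (polyGrowth_pow 1).mul (polyGrowth_besselJ 1)
  have h3 := laplaceInt_deriv p1 p0 (fun x => by
    refine ((hasDerivAt_id x).mul (hasDerivAt_besselJ_succ 0 x)).congr_deriv ?_
    have := besselJ_recurrence 0 x
    simp only [zero_add, Nat.cast_zero, mul_one, one_mul, id] at this ⊢
    linarith) hz
  simp only [id, zero_mul, Complex.ofReal_zero, sub_zero, one_mul] at h2 h3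
  linear_combination z * h2 - h3

/-- The domain on which `(1 + z ^ 2) ^ (-1 / 2)` is analytic. -/
def besselLaplaceDomain : Set ℂ := {z | 1 + z ^ 2 ∈ Complex.slitPlane}

lemma isOpen_besselLaplaceDomain : IsOpen besselLaplaceDomain :=
  Complex.isOpen_slitPlane.preimage (by fun_prop)

/-- The number `1 + z²` meets the cut only for `z = i y` with `|y| ≥ 1`. -/
lemma mem_besselLaplaceDomain {z : ℂ} (h : 0 < z.re ∨ 0 ≤ z.re ∧ |z.im| < 1) :
    z ∈ besselLaplaceDomain := by
  simp only [besselLaplaceDomain, mem_ofPred_eq, Complex.mem_slitPlane_iff]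
  have e1 : (1 + z ^ 2).re = 1 + z.re ^ 2 - z.im ^ 2 := by simp [pow_two]; ring
  have e2 : (1 + z ^ 2).im = 2 * z.re * z.im := by simp [pow_two]; ring
  rw [e1, e2]
  by_cases hi : z.im = 0
  · left; rw [hi]; nlinarith [sq_nonneg z.re]
  rcases h with h | ⟨h, h'⟩
  · right; positivity
  · left
    have : z.im ^ 2 < 1 := by rw [← sq_abs]; nlinarith [abs_nonneg z.im]
    nlinarith [sq_nonneg z.re]

lemma hasDerivAt_one_add_sq_cpow {z : ℂ} (hz : z ∈ besselLaplaceDomain) (c : ℂ) :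
    HasDerivAt (fun z : ℂ => (1 + z ^ 2) ^ c) (c * (1 + z ^ 2) ^ (c - 1) * (2 * z)) z := by
  have h : HasDerivAt (fun z : ℂ => 1 + z ^ 2) (2 * z) z := by
    simpa using (hasDerivAt_pow 2 z).const_add 1
  exact h.cpow_const hz

/-- Up to a real constant, the Laplace transform of `J_0` is `(1 + z ^ 2) ^ (-1 / 2)`. -/
lemma exists_laplaceInt_besselJ_zero_eq :
    ∃ c : ℝ, ∀ z : ℂ, 0 < z.re →
      laplaceInt (besselJ 0) z = c * (1 + z ^ 2) ^ (-(1 / 2) : ℂ) := by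
  set H : Set ℂ := {z | 0 < z.re} with hH
  have hHo : IsOpen H := isOpen_lt continuous_const Complex.continuous_re
  have hHc : Convex ℝ H := convex_halfSpace_re_gt 0
  -- The differential equation says exactly that this product has derivative zero.
  set G : ℂ → ℂ := fun z => laplaceInt (besselJ 0) z * (1 + z ^ 2) ^ (1 / 2 : ℂ) with hG
  have hne : ∀ z ∈ H, 1 + z ^ 2 ≠ 0 := fun z hz =>
    Complex.slitPlane_ne_zero (mem_besselLaplaceDomain (Or.inl hz))
  have hd : ∀ z ∈ H, HasDerivAt G 0 z := by
    intro z hz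
    obtain ⟨d, h1, h2⟩ := hasDerivAt_laplaceInt_besselJ_zero hz
    refine (h1.mul (hasDerivAt_one_add_sq_cpow (mem_besselLaplaceDomain (Or.inl hz))
      (1 / 2))).congr_deriv ?_
    rw [Complex.cpow_sub _ _ (hne z hz), Complex.cpow_one]
    have := hne z hz
    field_simp
    linear_combination (1 + z ^ 2) ^ (1 / 2 : ℂ) * h2
  have hconst : ∀ z ∈ H, G z = G 1 := fun z hz =>
    hHo.is_const_of_deriv_eq_zero hHc.isPreconnected
      (fun w hw => (hd w hw).differentiableAt.differentiableWithinAt)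
      (fun w hw => (hd w hw).deriv) hz (by simp [hH])
  -- The value of the constant never matters: being real is enough for the term to drop out of the
  -- real parts later.
  have hreal : ∃ c : ℝ, G 1 = c := by
    refine ⟨(∫ x in Ioi (0 : ℝ), Real.exp (-x) * besselJ 0 x) * (2 : ℝ) ^ (1 / 2 : ℝ), ?_⟩
    rw [hG, Complex.ofReal_mul, ← integral_complex_ofReal, Complex.ofReal_cpow (by norm_num)]
    simp only [laplaceInt]
    norm_num
  obtain ⟨c, hc⟩ := hreal
  refine ⟨c, fun z hz => ?_⟩
  rw [← hc, ← hconst z hz, hG]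
  simp only
  rw [mul_assoc, ← Complex.cpow_add _ _ (hne z hz)]
  simp

/-! ### The boundary behaviour of the Laplace transform of `x ^ (2 n + 1) J_{2 l}(x)` -/

open Polynomial in
/-- The coefficient of the Laplace transform of `J_0` in that of `J_n`. -/
noncomputable def besselLaplaceP : ℕ → ℝ[X]
  | 0 => 1
  | 1 => -X
  | n + 2 => besselLaplaceP n - C 2 * X * besselLaplaceP (n + 1)

open Polynomial in
/-- The polynomial part of the Laplace transform of `J_n`. -/
noncomputable def besselLaplaceQ : ℕ → ℝ[X]
  | 0 => 0
  | 1 => 1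
  | n + 2 => besselLaplaceQ n - C 2 * X * besselLaplaceQ (n + 1)

/-- The weights `2 ^ (2 k + 2) (l + k)! / (l - k - 1)!`, which vanish for `k ≥ l`. -/
def besselWeight (l k : ℕ) : ℝ := 2 ^ (2 * k + 2) * ((l + k).descFactorial (2 * k + 1) : ℝ)

lemma besselWeight_eq_zero {l k : ℕ} (h : l ≤ k) : besselWeight l k = 0 := by
  rw [besselWeight, Nat.descFactorial_of_lt (by omega)]; simp

lemma besselWeight_eq {l k : ℕ} (h : k < l) :
    besselWeight l k = 2 ^ (2 * k + 2) *
      ((Nat.factorial (l + k) : ℝ) / (Nat.factorial (l - k - 1) : ℝ)) := by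
  have := Nat.factorial_mul_descFactorial (n := l + k) (k := 2 * k + 1) (by omega)
  rw [show l + k - (2 * k + 1) = l - k - 1 by omega] at this
  rw [besselWeight, ← this]
  push_cast
  field_simp

lemma laplaceInt_besselJ_eq (n : ℕ) {z : ℂ} (hz : 0 < z.re) :
    laplaceInt (besselJ n) z = Polynomial.aeval z (besselLaplaceP n) * laplaceInt (besselJ 0) z +
      Polynomial.aeval z (besselLaplaceQ n) := by
  induction n using Nat.twoStepInduction with
  | zero => simp [besselLaplaceP, besselLaplaceQ]
  | one => simp [besselLaplaceP, besselLaplaceQ, laplaceInt_besselJ_one hz]; ring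
  | more n h0 h1 =>
    rw [laplaceInt_besselJ_add_two n hz, h0, h1]
    simp [besselLaplaceP, besselLaplaceQ]
    ring

/-- The recursion alternates parity: even indices give even polynomials and odd indices odd ones,
all with real coefficients. -/
lemma im_aeval_besselLaplaceP (l : ℕ) (t : ℝ) :
    (Polynomial.aeval (t * Complex.I) (besselLaplaceP (2 * l))).im = 0 ∧
      (Polynomial.aeval (t * Complex.I) (besselLaplaceP (2 * l + 1))).re = 0 := by
  induction l with
  | zero => simp [besselLaplaceP]
  | succ l ih =>
    have h1 : (Polynomial.aeval (t * Complex.I) (besselLaplaceP (2 * l + 2))).im = 0 := by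
      simp [besselLaplaceP, ih.1, ih.2]
    refine ⟨h1, ?_⟩
    rw [show 2 * (l + 1) + 1 = 2 * l + 1 + 2 by ring, besselLaplaceP]
    rw [show 2 * l + 1 + 1 = 2 * l + 2 by ring]
    simp [ih.2, h1]

open Polynomial in
-- Pascal's rule, once for each parity. Coefficients of the other parity are not needed: after an
-- odd number of derivatives of the even-index polynomial they land on odd powers of `i t`, which
-- are imaginary.
lemma coeff_besselLaplaceQ (l : ℕ) :
    (∀ i, (besselLaplaceQ (2 * l)).coeff (2 * i + 1) =
      -(2 ^ (2 * i + 1) * ((l + i).choose (2 * i + 1) : ℝ))) ∧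
    (∀ i, (besselLaplaceQ (2 * l + 1)).coeff (2 * i) =
      2 ^ (2 * i) * ((l + i).choose (2 * i) : ℝ)) := by
  have hX : ∀ (p : ℝ[X]) (i : ℕ), (C 2 * X * p).coeff (i + 1) = 2 * p.coeff i := by
    intro p i
    rw [mul_assoc, coeff_C_mul, coeff_X_mul]
  have hX0 : ∀ (p : ℝ[X]), (C 2 * X * p).coeff 0 = 0 := by intro p; simp
  induction l with
  | zero =>
    refine ⟨fun i => ?_, fun i => ?_⟩
    · rw [Nat.choose_eq_zero_of_lt (by omega)]; simp [besselLaplaceQ]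
    · cases i with
      | zero => simp [besselLaplaceQ]
      | succ i =>
        rw [Nat.choose_eq_zero_of_lt (by omega)]
        simp [besselLaplaceQ, coeff_one]
  | succ l ih =>
    have h1 : ∀ i, (besselLaplaceQ (2 * l + 2)).coeff (2 * i + 1) =
        -(2 ^ (2 * i + 1) * ((l + 1 + i).choose (2 * i + 1) : ℝ)) := by
      intro i
      rw [besselLaplaceQ, coeff_sub, hX, ih.1, ih.2, show l + 1 + i = l + i + 1 by ring,
        Nat.choose_succ_succ]
      push_cast; ring
    refine ⟨h1, fun i => ?_⟩
    rw [show 2 * (l + 1) + 1 = 2 * l + 1 + 2 by ring, besselLaplaceQ, coeff_sub, ih.2]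
    cases i with
    | zero => simp
    | succ i =>
      rw [show 2 * (i + 1) = 2 * i + 1 + 1 by ring, hX, h1,
        show l + 1 + (i + 1) = l + (i + 1) + 1 by ring, Nat.choose_succ_succ (l + (i + 1)),
        show l + (i + 1) = l + 1 + i by ring]
      push_cast; ring

lemma re_aeval_mul_I (R : Polynomial ℝ) {S : ℕ} (hS : R.natDegree < 2 * S) (t : ℝ) :
    (Polynomial.aeval (t * Complex.I) R).re =
      ∑ s ∈ Finset.range S, R.coeff (2 * s) * ((-1) ^ s * t ^ (2 * s)) := by
  rw [Polynomial.aeval_eq_sum_range' hS, Complex.re_sum]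
  clear hS
  induction S with
  | zero => simp
  | succ S ih =>
    rw [show 2 * (S + 1) = 2 * S + 1 + 1 by ring, Finset.sum_range_succ, Finset.sum_range_succ, ih,
      Finset.sum_range_succ]
    have h1 : ((t : ℂ) * Complex.I) ^ (2 * S) = (((-1) ^ S * t ^ (2 * S) : ℝ) : ℂ) := by
      rw [mul_pow, pow_mul Complex.I, Complex.I_sq]; push_cast; ring
    have h2 : ((t : ℂ) * Complex.I) ^ (2 * S + 1) =
        (((-1) ^ S * t ^ (2 * S + 1) : ℝ) : ℂ) * Complex.I := by
      rw [pow_succ, h1]; push_cast; ring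
    rw [h1, h2]
    simp only [Complex.smul_re, Complex.ofReal_re, Complex.re_ofReal_mul, Complex.I_re, mul_zero,
      smul_eq_mul, add_zero]

lemma iteratedDeriv_aeval (R : Polynomial ℝ) (k : ℕ) :
    iteratedDeriv k (fun z : ℂ => Polynomial.aeval z R) =
      fun z => Polynomial.aeval z (Polynomial.derivative^[k] R) := by
  induction k with
  | zero => simp
  | succ k ih =>
    rw [iteratedDeriv_succ, ih, Function.iterate_succ_apply']
    ext z
    exact (Polynomial.hasDerivAt_aeval _ z).deriv

lemma re_iteratedDeriv_besselLaplaceQ (l n : ℕ) (t : ℝ) :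
    (iteratedDeriv (2 * n + 1)
      (fun z : ℂ => Polynomial.aeval z (besselLaplaceQ (2 * l))) (t * Complex.I)).re =
      -∑ s ∈ Finset.range l, (1 / 2) * besselWeight l (n + s) *
        ((-1) ^ s * t ^ (2 * s) / (Nat.factorial (2 * s) : ℝ)) := by
  set R := Polynomial.derivative^[2 * n + 1] (besselLaplaceQ (2 * l)) with hR
  -- The range is taken long enough both to exhaust `R` and to contain `range l`; the surplus terms
  -- vanish with the weights.
  rw [iteratedDeriv_aeval, ← hR, re_aeval_mul_I R (S := R.natDegree + l + 1) (by omega),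
    ← Finset.sum_neg_distrib]
  have hc : ∀ s, R.coeff (2 * s) * ((-1) ^ s * t ^ (2 * s)) =
      -((1 / 2) * besselWeight l (n + s) *
        ((-1) ^ s * t ^ (2 * s) / (Nat.factorial (2 * s) : ℝ))) := by
    intro s
    have h1 := Nat.factorial_mul_descFactorial (n := 2 * s + (2 * n + 1)) (k := 2 * n + 1) (by omega)
    rw [Nat.add_sub_cancel] at h1
    have h2 : ((2 * s).factorial : ℝ) * ((2 * s + (2 * n + 1)).descFactorial (2 * n + 1) : ℝ) =
      ((2 * s + (2 * n + 1)).factorial : ℝ) := by exact_mod_cast h1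
    rw [hR, Polynomial.coeff_iterate_derivative, besselWeight, Nat.descFactorial_eq_factorial_mul_choose
      (l + (n + s)), show 2 * s + (2 * n + 1) = 2 * (n + s) + 1 by ring,
      (coeff_besselLaplaceQ l).1]
    rw [show 2 * s + (2 * n + 1) = 2 * (n + s) + 1 by ring] at h2
    push_cast
    rw [← h2, nsmul_eq_mul]
    have : ((2 * s).factorial : ℝ) ≠ 0 := by positivity
    field_simp
    ring
  rw [Finset.sum_congr rfl fun s _ => hc s]
  refine (Finset.sum_subset (fun s hs => ?_) fun s _ hs => ?_).symm
  · simp only [Finset.mem_range] at hs ⊢; omega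
  · rw [besselWeight_eq_zero (by simp only [Finset.mem_range] at hs; omega)]; simp

/-- Each function `t ↦ I^k f^(k)(t I)` is the derivative of its predecessor in the real variable
`t`, and derivatives of real-valued functions are real. -/
lemma im_I_pow_mul_iteratedDeriv {f : ℂ → ℂ} {U : Set ℂ} (hU : IsOpen U)
    (hf : DifferentiableOn ℂ f U) (hUI : ∀ t : ℝ, |t| < 1 → (t * Complex.I : ℂ) ∈ U)
    (h0 : ∀ t : ℝ, |t| < 1 → (f (t * Complex.I)).im = 0) (k : ℕ) {t : ℝ} (ht : |t| < 1) :
    (Complex.I ^ k * iteratedDeriv k f (t * Complex.I)).im = 0 := by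
  induction k generalizing t with
  | zero => simpa using h0 t ht
  | succ k ih =>
    have ha : AnalyticAt ℂ (iteratedDeriv k f) (t * Complex.I) := by
      rw [iteratedDeriv_eq_iterate]
      exact (hf.analyticOnNhd hU).iterated_deriv k _ (hUI t ht)
    have h1 : HasDerivAt (fun t : ℝ => (t : ℂ) * Complex.I) Complex.I t := by
      simpa using (hasDerivAt_id t).ofReal_comp.mul_const Complex.I
    have h2 : HasDerivAt (fun t : ℝ => Complex.I ^ k * iteratedDeriv k f (t * Complex.I))
        (Complex.I ^ (k + 1) * iteratedDeriv (k + 1) f (t * Complex.I)) t := by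
      refine ((ha.differentiableAt.hasDerivAt.comp t h1).const_mul _).congr_deriv ?_
      rw [iteratedDeriv_succ]; ring
    have h3 := (Complex.imCLM.hasFDerivAt.comp_hasDerivAt t h2)
    have h4 : (fun _ : ℝ => (0 : ℝ)) =ᶠ[𝓝 t]
        Complex.imCLM ∘ fun t : ℝ => Complex.I ^ k * iteratedDeriv k f (t * Complex.I) := by
      have : {s : ℝ | |s| < 1} ∈ 𝓝 t := (isOpen_lt continuous_abs continuous_const).mem_nhds ht
      filter_upwards [this] with s hs
      exact (ih hs).symm
    have h5 := (h3.congr_of_eventuallyEq h4).unique (hasDerivAt_const t 0)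
    simpa using h5

/-- The extension is minus the derivative of order `2 n + 1` of `F + Q`, analytic across the segment
from `-i` to `i`. There `F` is real, so its odd derivatives are imaginary and the real part comes
from `Q` alone. -/
lemma exists_laplaceInt_pow_mul_besselJ_extension (l n : ℕ) :
    ∃ D : ℂ → ℂ, ContinuousOn D besselLaplaceDomain ∧
      (∀ z : ℂ, 0 < z.re → laplaceInt (fun x => x ^ (2 * n + 1) * besselJ (2 * l) x) z = D z) ∧
      ∀ t : ℝ, |t| < 1 → (D (t * Complex.I)).re =
        ∑ s ∈ Finset.range l, (1 / 2) * besselWeight l (n + s) *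
          ((-1) ^ s * t ^ (2 * s) / (Nat.factorial (2 * s) : ℝ)) := by
  obtain ⟨c, hc⟩ := exists_laplaceInt_besselJ_zero_eq
  set F : ℂ → ℂ := fun z => Polynomial.aeval z (besselLaplaceP (2 * l)) *
    (c * (1 + z ^ 2) ^ (-(1 / 2) : ℂ)) with hF
  set Q : ℂ → ℂ := fun z => Polynomial.aeval z (besselLaplaceQ (2 * l)) with hQ
  have hFd : DifferentiableOn ℂ F besselLaplaceDomain := fun z hz =>
    ((Polynomial.differentiableAt_aeval _).mul ((hasDerivAt_one_add_sq_cpow hz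
      _).differentiableAt.const_mul _)).differentiableWithinAt
  have hQd : Differentiable ℂ Q := fun z => Polynomial.differentiableAt_aeval _
  have hFQ : AnalyticOnNhd ℂ (F + Q) besselLaplaceDomain :=
    (hFd.add hQd.differentiableOn).analyticOnNhd isOpen_besselLaplaceDomain
  have hUI : ∀ t : ℝ, |t| < 1 → (t * Complex.I : ℂ) ∈ besselLaplaceDomain := fun t ht =>
    mem_besselLaplaceDomain (Or.inr (by simpa using ht))
  refine ⟨fun z => -iteratedDeriv (2 * n + 1) (F + Q) z, ?_, fun z hz => ?_, fun t ht => ?_⟩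
  · rw [iteratedDeriv_eq_iterate]
    exact (hFQ.iterated_deriv _).continuousOn.neg
  · have hev : laplaceInt (besselJ (2 * l)) =ᶠ[𝓝 z] F + Q := by
      filter_upwards [(isOpen_lt continuous_const Complex.continuous_re).mem_nhds hz] with w hw
      rw [laplaceInt_besselJ_eq _ hw, hc w hw]; rfl
    have := (polyGrowth_besselJ (2 * l)).iteratedDeriv_laplaceInt (2 * n + 1) hz
    rw [hev.iteratedDeriv_eq, Odd.neg_one_pow ⟨n, rfl⟩] at this
    linear_combination this
  · have hF' : ContDiffAt ℂ (2 * n + 1 : ℕ) F (t * Complex.I) :=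
      ((hFd.analyticOnNhd isOpen_besselLaplaceDomain) _ (hUI t ht)).contDiffAt
    have hQ' : ContDiffAt ℂ (2 * n + 1 : ℕ) Q (t * Complex.I) :=
      hQd.contDiff.contDiffAt
    have him : ∀ t : ℝ, |t| < 1 → (F (t * Complex.I)).im = 0 := by
      intro t ht
      have h1 : (0 : ℝ) ≤ 1 - t ^ 2 := by
        have : t ^ 2 < 1 := by rw [← sq_abs]; nlinarith [abs_nonneg t]
        linarith
      have h2 : (1 + ((t : ℂ) * Complex.I) ^ 2) ^ (-(1 / 2) : ℂ) =
          (((1 - t ^ 2) ^ (-(1 / 2) : ℝ) : ℝ) : ℂ) := by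
        rw [Complex.ofReal_cpow h1, mul_pow, Complex.I_sq]
        push_cast; ring_nf
      rw [hF]
      simp only
      rw [h2, ← Complex.ofReal_mul, Complex.im_mul_ofReal, (im_aeval_besselLaplaceP l t).1, zero_mul]
    have h1 := im_I_pow_mul_iteratedDeriv isOpen_besselLaplaceDomain hFd hUI him (2 * n + 1) ht
    have h2 : (iteratedDeriv (2 * n + 1) F (t * Complex.I)).re = 0 := by
      have e : Complex.I ^ (2 * n + 1) = (((-1) ^ n : ℝ) : ℂ) * Complex.I := by
        rw [pow_succ, pow_mul, Complex.I_sq]; push_cast; rfl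
      rw [e, mul_assoc, Complex.im_ofReal_mul] at h1
      simpa using h1
    rw [Complex.neg_re, iteratedDeriv_add hF' hQ', Complex.add_re, h2,
      re_iteratedDeriv_besselLaplaceQ]
    ring

/-! ### Abel means of Bessel integrals of band-limited functions -/

/-- Fourier transforms of finite measures supported in `[-σ, σ]`. -/
def IsBandLimited (σ : ℝ) (f : ℝ → ℝ) : Prop :=
  ∃ μ : Measure ℝ, IsFiniteMeasure μ ∧ (∀ᵐ t ∂μ, |t| ≤ σ) ∧ ∀ x, charFun μ x = f x

/-- The Abel means of the moments `∫ x ^ (2 n + 1) f(x) J_{2 l}(x) dx` converge to a linear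
combination of the Taylor coefficients of `f`. -/
def HasAbelBesselMoments (l : ℕ) (f : ℝ → ℝ) : Prop :=
  (∀ k : ℕ, ContDiff ℝ k f) ∧ PolyGrowth f ∧ ∀ n : ℕ,
    Tendsto (fun ε : ℝ => ∫ x in Ioi (0 : ℝ),
        Real.exp (-ε * x) * (x ^ (2 * n + 1) * f x * besselJ (2 * l) x)) (𝓝[>] 0)
      (𝓝 (∑ s ∈ Finset.range l, (1 / 2) * besselWeight l (n + s) *
        (iteratedDeriv (2 * s) f 0 / (Nat.factorial (2 * s) : ℝ))))

lemma iteratedDeriv_ofReal_comp {f : ℝ → ℝ} (hf : ∀ k : ℕ, ContDiff ℝ k f) (k : ℕ) :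
    iteratedDeriv k (fun x => (f x : ℂ)) = fun x => ((iteratedDeriv k f x : ℝ) : ℂ) := by
  induction k with
  | zero => simp
  | succ k ih =>
    rw [iteratedDeriv_succ, ih, iteratedDeriv_succ]
    ext x
    exact (((hf (k + 1)).differentiable_iteratedDeriv' k) x).hasDerivAt.ofReal_comp.deriv

lemma memLp_id_of_ae_abs_le {μ : Measure ℝ} [IsFiniteMeasure μ] {σ : ℝ} (h : ∀ᵐ t ∂μ, |t| ≤ σ)
    (p : ENNReal) : MemLp id p μ :=
  MemLp.of_bound aestronglyMeasurable_id σ (by simpa using h)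

lemma IsBandLimited.contDiff {σ : ℝ} {f : ℝ → ℝ} (hf : IsBandLimited σ f) (k : ℕ) :
    ContDiff ℝ k f := by
  obtain ⟨μ, hμ, hσ, h⟩ := hf
  have e : f = Complex.reCLM ∘ charFun μ := by ext x; simp [h]
  rw [e]
  exact Complex.reCLM.contDiff.comp (contDiff_charFun (memLp_id_of_ae_abs_le hσ k))

lemma IsBandLimited.polyGrowth {σ : ℝ} {f : ℝ → ℝ} (hf : IsBandLimited σ f) : PolyGrowth f := by
  refine ⟨contDiff_zero.1 (by exact_mod_cast hf.contDiff 0), ?_⟩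
  obtain ⟨μ, hμ, hσ, h⟩ := hf
  refine ⟨μ.real univ, 0, fun x _ => ?_⟩
  have := norm_charFun_le (μ := μ) x
  rw [h, Complex.norm_real] at this
  simpa using this

lemma iteratedDeriv_two_mul_of_charFun_eq {μ : Measure ℝ} [IsFiniteMeasure μ] {σ : ℝ}
    (hσ : ∀ᵐ t ∂μ, |t| ≤ σ) {f : ℝ → ℝ} (h : ∀ x, charFun μ x = f x) (s : ℕ) :
    iteratedDeriv (2 * s) f 0 = (-1) ^ s * ∫ t, t ^ (2 * s) ∂μ := by
  have hf : IsBandLimited σ f := ⟨μ, inferInstance, hσ, h⟩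
  have h1 := iteratedDeriv_charFun_zero (memLp_id_of_ae_abs_le hσ ((2 * s : ℕ) : ENNReal))
  rw [funext h, iteratedDeriv_ofReal_comp hf.contDiff, pow_mul, Complex.I_sq] at h1
  beta_reduce at h1
  exact_mod_cast h1

/-- Fubini, legitimate thanks to `e^{-εx}`; the oscillation `e^{ixt}` shifts the Laplace variable
from `ε` to `ε - i t`. -/
lemma integral_exp_mul_charFun {μ : Measure ℝ} [IsFiniteMeasure μ] {G : ℝ → ℝ} (hG : PolyGrowth G)
    {ε : ℝ} (hε : 0 < ε) :
    ∫ x in Ioi (0 : ℝ), ((Real.exp (-ε * x) * G x : ℝ) : ℂ) * charFun μ x =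
      ∫ t, laplaceInt G (ε + ((-t : ℝ) : ℂ) * Complex.I) ∂μ := by
  have e : ∀ x t : ℝ, ((Real.exp (-ε * x) * G x : ℝ) : ℂ) * Complex.exp (x * t * Complex.I) =
      Complex.exp (-((ε + ((-t : ℝ) : ℂ) * Complex.I) * x)) * G x := by
    intro x t
    have : Complex.exp (-((ε + ((-t : ℝ) : ℂ) * Complex.I) * x)) =
        Complex.exp (-ε * x) * Complex.exp (x * t * Complex.I) := by
      rw [← Complex.exp_add]; congr 1; push_cast; ring
    rw [this]; push_cast; ring
  have hGc := hG.1
  have h1 : Integrable (fun x : ℝ => Real.exp (-ε * x) * G x) (volume.restrict (Ioi 0)) := by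
    have := (hG.integrableOn_laplace (z := ε) (by simpa using hε)).re
    refine this.congr (Eventually.of_forall fun x => ?_)
    have : Complex.exp (-(ε * x)) * G x = ((Real.exp (-ε * x) * G x : ℝ) : ℂ) := by push_cast; simp
    simp only [this]
    exact Complex.ofReal_re _
  have hint : Integrable (Function.uncurry fun x t : ℝ =>
      ((Real.exp (-ε * x) * G x : ℝ) : ℂ) * Complex.exp (x * t * Complex.I))
      ((volume.restrict (Ioi (0 : ℝ))).prod μ) := by
    refine Integrable.mono' (h1.norm.mul_prod (integrable_const (1 : ℝ))) ?_ ?_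
    · refine Continuous.aestronglyMeasurable ?_
      unfold Function.uncurry
      fun_prop
    · refine Eventually.of_forall fun p => ?_
      simp only [Function.uncurry, norm_mul, Complex.norm_real]
      rw [show (p.1 : ℂ) * p.2 * Complex.I = ((p.1 * p.2 : ℝ) : ℂ) * Complex.I by push_cast; ring,
        Complex.norm_exp_ofReal_mul_I]
  calc _ = ∫ x in Ioi (0 : ℝ), ∫ t, ((Real.exp (-ε * x) * G x : ℝ) : ℂ) *
        Complex.exp (x * t * Complex.I) ∂μ := by
        congr 1; ext x; rw [charFun_apply_real, integral_const_mul]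
    _ = ∫ t : ℝ, (∫ x in Ioi (0 : ℝ), ((Real.exp (-ε * x) * G x : ℝ) : ℂ) *
        Complex.exp (x * t * Complex.I)) ∂μ := integral_integral_swap hint
    _ = _ := by simp only [e, laplaceInt]

/-- Since `σ < 1`, the points `ε - i t` stay in a compact rectangle away from the branch cuts. The
continued transform is bounded there, so `ε → 0` passes under the integral over `μ`. The real part
of the limit is a combination of even moments, which are the even derivatives of `f` at `0` up to
sign. -/
lemma IsBandLimited.hasAbelBesselMoments {σ : ℝ} (hσ1 : σ < 1) {f : ℝ → ℝ}
    (hf : IsBandLimited σ f) (l : ℕ) : HasAbelBesselMoments l f := by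
  refine ⟨hf.contDiff, hf.polyGrowth, fun n => ?_⟩
  obtain ⟨μ, hμ, hσ, h⟩ := hf
  obtain ⟨D, hDc, hD, hDre⟩ := exists_laplaceInt_pow_mul_besselJ_extension l n
  set G : ℝ → ℝ := fun x => x ^ (2 * n + 1) * besselJ (2 * l) x with hG
  have hGp : PolyGrowth G := (polyGrowth_pow _).mul (polyGrowth_besselJ _)
  have hre : ∀ ε t : ℝ, ((ε : ℂ) + ((-t : ℝ) : ℂ) * Complex.I).re = ε := by
    intro ε t; simp
  have him : ∀ ε t : ℝ, ((ε : ℂ) + ((-t : ℝ) : ℂ) * Complex.I).im = -t := by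
    intro ε t; simp
  have hlim : Tendsto (fun ε : ℝ => ∫ t, D (ε + ((-t : ℝ) : ℂ) * Complex.I) ∂μ) (𝓝[>] 0)
      (𝓝 (∫ t, D (((-t : ℝ) : ℂ) * Complex.I) ∂μ)) := by
    have hK : IsCompact (Icc (0 : ℝ) 1 ×ℂ Icc (-σ) σ) := isCompact_Icc.reProdIm isCompact_Icc
    have hKU : Icc (0 : ℝ) 1 ×ℂ Icc (-σ) σ ⊆ besselLaplaceDomain := fun z hz =>
      mem_besselLaplaceDomain (Or.inr ⟨hz.1.1, (abs_le.2 hz.2).trans_lt hσ1⟩)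
    obtain ⟨B, hB⟩ := hK.exists_bound_of_continuousOn (hDc.mono hKU)
    have hsmall : ∀ᶠ ε : ℝ in 𝓝[>] 0, ε ∈ Ioc (0 : ℝ) 1 := Ioc_mem_nhdsGT one_pos
    refine tendsto_integral_filter_of_dominated_convergence (fun _ => B) ?_ ?_
      (integrable_const B) ?_
    · filter_upwards [hsmall] with ε hε
      refine Continuous.aestronglyMeasurable (hDc.comp_continuous (by fun_prop) fun t => ?_)
      exact mem_besselLaplaceDomain (Or.inl (by rw [hre]; exact hε.1))
    · filter_upwards [hsmall] with ε hε
      filter_upwards [hσ] with t ht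
      refine hB _ ⟨?_, ?_⟩
      · simp only [mem_preimage, hre]; exact ⟨hε.1.le, hε.2⟩
      · simp only [mem_preimage, him]; exact abs_le.1 (by rwa [abs_neg])
    · filter_upwards [hσ] with t ht
      have hmem : ((-t : ℝ) : ℂ) * Complex.I ∈ besselLaplaceDomain :=
        mem_besselLaplaceDomain (Or.inr (by simpa using ht.trans_lt hσ1))
      have hcont := (hDc.continuousAt (isOpen_besselLaplaceDomain.mem_nhds hmem)).tendsto
      refine hcont.comp ?_
      have : Continuous fun ε : ℝ => (ε : ℂ) + ((-t : ℝ) : ℂ) * Complex.I := by fun_prop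
      have := (this.tendsto 0).mono_left (nhdsWithin_le_nhds (s := Ioi 0))
      simpa using this
  have hlim' := (Complex.continuous_re.tendsto _).comp hlim
  have hval : (∫ t, D (((-t : ℝ) : ℂ) * Complex.I) ∂μ).re =
      ∑ s ∈ Finset.range l, (1 / 2) * besselWeight l (n + s) *
        (iteratedDeriv (2 * s) f 0 / (Nat.factorial (2 * s) : ℝ)) := by
    have hDre' : ∀ᵐ t ∂μ, (D (((-t : ℝ) : ℂ) * Complex.I)).re =
        ∑ s ∈ Finset.range l, (1 / 2) * besselWeight l (n + s) *
          ((-1) ^ s * t ^ (2 * s) / (Nat.factorial (2 * s) : ℝ)) := by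
      filter_upwards [hσ] with t ht
      rw [hDre (-t) (by rw [abs_neg]; exact ht.trans_lt hσ1)]
      simp only [(even_two_mul _).neg_pow]
    have hpow : ∀ s : ℕ, Integrable (fun t : ℝ => t ^ (2 * s)) μ := fun s =>
      Integrable.of_bound (by fun_prop) (σ ^ (2 * s)) (by
        filter_upwards [hσ] with t ht
        rw [norm_pow]
        exact pow_le_pow_left₀ (abs_nonneg t) ht _)
    have hDint : Integrable (fun t : ℝ => D (((-t : ℝ) : ℂ) * Complex.I)) μ := by
      have hm : IsCompact (Icc (-σ) σ) := isCompact_Icc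
      have hc : ContinuousOn (fun t : ℝ => D (((-t : ℝ) : ℂ) * Complex.I)) (Icc (-σ) σ) := by
        refine hDc.comp (by fun_prop) fun t ht => ?_
        exact mem_besselLaplaceDomain (Or.inr (by simpa using (abs_le.2 ht).trans_lt hσ1))
      have hio : IntegrableOn (fun t : ℝ => D (((-t : ℝ) : ℂ) * Complex.I)) (Icc (-σ) σ) μ :=
        hc.integrableOn_compact hm
      -- `μ` is carried by `[-σ, σ]`, so restricting to that interval changes nothing.
      rwa [IntegrableOn, Measure.restrict_eq_self_of_ae_mem] at hio
      filter_upwards [hσ] with t ht using abs_le.1 ht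
    have : (∫ t, D (((-t : ℝ) : ℂ) * Complex.I) ∂μ).re =
        ∫ t, (D (((-t : ℝ) : ℂ) * Complex.I)).re ∂μ :=
      (Complex.reCLM.integral_comp_comm hDint).symm
    rw [this, integral_congr_ae hDre', integral_finsetSum]
    · refine Finset.sum_congr rfl fun s _ => ?_
      rw [iteratedDeriv_two_mul_of_charFun_eq hσ h, integral_const_mul, integral_div,
        integral_const_mul]
    · intro s _
      exact (((hpow s).const_mul _).div_const _).const_mul _
  rw [← hval]
  refine hlim'.congr' ?_
  filter_upwards [self_mem_nhdsWithin] with ε hε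
  have hε' : (0 : ℝ) < ε := hε
  simp only [Function.comp_apply]
  have h1 : ∫ t, D (ε + ((-t : ℝ) : ℂ) * Complex.I) ∂μ =
      ∫ x in Ioi (0 : ℝ), ((Real.exp (-ε * x) * G x : ℝ) : ℂ) * charFun μ x := by
    rw [integral_exp_mul_charFun hGp hε']
    congr 1; ext t
    exact (hD _ (by rw [hre]; exact hε')).symm
  rw [h1]
  have h2 : ∀ x : ℝ, ((Real.exp (-ε * x) * G x : ℝ) : ℂ) * charFun μ x =
      ((Real.exp (-ε * x) * (x ^ (2 * n + 1) * f x * besselJ (2 * l) x) : ℝ) : ℂ) := by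
    intro x; rw [h, hG]; push_cast; ring
  simp only [h2]
  rw [integral_complex_ofReal, Complex.ofReal_re]

/-! ### Multiplication by even quadratics -/

lemma iteratedDeriv_id_mul {f : ℝ → ℝ} (hf : ∀ k : ℕ, ContDiff ℝ k f) (k : ℕ) :
    iteratedDeriv (k + 1) (fun x => x * f x) =
      fun x => x * iteratedDeriv (k + 1) f x + (k + 1) * iteratedDeriv k f x := by
  have hd : ∀ k x, HasDerivAt (iteratedDeriv k f) (iteratedDeriv (k + 1) f x) x := by
    intro k x
    rw [iteratedDeriv_succ]
    exact (((hf (k + 1)).differentiable_iteratedDeriv' k) x).hasDerivAt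
  induction k with
  | zero =>
    rw [iteratedDeriv_one]
    ext x
    have h0 := hd 0 x
    rw [iteratedDeriv_zero] at h0
    rw [((hasDerivAt_id' x).fun_mul h0).deriv]
    simp; ring
  | succ k ih =>
    rw [iteratedDeriv_succ, ih]
    ext x
    rw [(((hasDerivAt_id' x).fun_mul (hd (k + 1) x)).fun_add ((hd k x).const_mul _)).deriv]
    push_cast; ring

lemma iteratedDeriv_sq_mul_zero {f : ℝ → ℝ} (hf : ∀ k : ℕ, ContDiff ℝ k f) (k : ℕ) :
    iteratedDeriv (k + 2) (fun x => x ^ 2 * f x) 0 = (k + 2) * (k + 1) * iteratedDeriv k f 0 := by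
  have hx : ∀ k : ℕ, ContDiff ℝ k fun x => x * f x := fun k => contDiff_id.mul (hf k)
  have e : (fun x => x ^ 2 * f x) = fun x => x * (x * f x) := by ext x; ring
  rw [e, iteratedDeriv_id_mul hx (k + 1), iteratedDeriv_id_mul hf k]
  push_cast; ring

lemma iteratedDeriv_quadratic_mul_zero {f : ℝ → ℝ} (hf : ∀ k : ℕ, ContDiff ℝ k f) (a b : ℝ)
    (k : ℕ) :
    iteratedDeriv k (fun x => (a - b * x ^ 2) * f x) 0 =
      a * iteratedDeriv k f 0 - b * iteratedDeriv k (fun x => x ^ 2 * f x) 0 := by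
  have hx : ContDiff ℝ k fun x => x ^ 2 * f x := (contDiff_id.pow 2).mul (hf k)
  have e : (fun x => (a - b * x ^ 2) * f x) =
      (fun x => a * f x) - fun x => b * (x ^ 2 * f x) := by
    ext x; simp only [Pi.sub_apply]; ring
  rw [e, iteratedDeriv_sub (contDiff_const.mul (hf k)).contDiffAt
    (contDiff_const.mul hx).contDiffAt, iteratedDeriv_const_mul_field,
    iteratedDeriv_const_mul_field]

lemma PolyGrowth.integrableOn_exp_mul {f : ℝ → ℝ} (hf : PolyGrowth f) {ε : ℝ} (hε : 0 < ε) :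
    IntegrableOn (fun x : ℝ => Real.exp (-ε * x) * f x) (Ioi 0) := by
  obtain ⟨hfc, C, N, hC⟩ := hf
  refine Integrable.mono' ((integrableOn_one_add_pow_mul_exp_neg N hε).const_mul C)
    (by fun_prop) ?_
  filter_upwards [ae_restrict_mem measurableSet_Ioi] with x hx
  rw [norm_mul, Real.norm_of_nonneg (Real.exp_pos _).le]
  calc _ ≤ Real.exp (-ε * x) * (C * (1 + x) ^ N) := by gcongr; exact hC x (le_of_lt hx)
    _ = _ := by ring

/-- Multiplying by `x²` raises `n` by one in the integral and moves each Taylor coefficient up two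
places. The weight depends only on `n + s`, so both shifts agree. -/
lemma HasAbelBesselMoments.quadratic_mul {l : ℕ} {f : ℝ → ℝ} (hf : HasAbelBesselMoments l f)
    (a b : ℝ) : HasAbelBesselMoments l fun x => (a - b * x ^ 2) * f x := by
  obtain ⟨hfc, hfp, hfl⟩ := hf
  have hq : PolyGrowth fun x : ℝ => a - b * x ^ 2 :=
    (polyGrowth_const a).sub ((polyGrowth_const b).mul (polyGrowth_pow 2))
  refine ⟨fun k => (contDiff_const.sub (contDiff_const.mul (contDiff_id.pow 2))).mul (hfc k),
    hq.mul hfp, fun n => ?_⟩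
  have h := ((hfl n).const_mul a).sub ((hfl (n + 1)).const_mul b)
  have hval : ∑ s ∈ Finset.range l, (1 / 2) * besselWeight l (n + s) *
        (iteratedDeriv (2 * s) (fun x => (a - b * x ^ 2) * f x) 0 / (Nat.factorial (2 * s) : ℝ)) =
      a * (∑ s ∈ Finset.range l, (1 / 2) * besselWeight l (n + s) *
        (iteratedDeriv (2 * s) f 0 / (Nat.factorial (2 * s) : ℝ))) -
      b * ∑ s ∈ Finset.range l, (1 / 2) * besselWeight l (n + 1 + s) *
        (iteratedDeriv (2 * s) f 0 / (Nat.factorial (2 * s) : ℝ)) := by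
    have hs : ∑ s ∈ Finset.range l, (1 / 2) * besselWeight l (n + s) *
        (iteratedDeriv (2 * s) (fun x => x ^ 2 * f x) 0 / (Nat.factorial (2 * s) : ℝ)) =
        ∑ s ∈ Finset.range l, (1 / 2) * besselWeight l (n + 1 + s) *
        (iteratedDeriv (2 * s) f 0 / (Nat.factorial (2 * s) : ℝ)) := by
      cases l with
      | zero => simp
      | succ l =>
        -- The reindexing is exact: on the left the first term is zero because `x² f` vanishes at
        -- `0`, on the right the last one because its weight does.
        rw [Finset.sum_range_succ', Finset.sum_range_succ _ l,
          besselWeight_eq_zero (show l + 1 ≤ n + 1 + l by omega)]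
        have h0 : iteratedDeriv (2 * 0) (fun x => x ^ 2 * f x) 0 = 0 := by simp
        rw [h0]
        simp only [zero_div, mul_zero, zero_mul, add_zero]
        refine Finset.sum_congr rfl fun s _ => ?_
        rw [show 2 * (s + 1) = 2 * s + 2 by ring, iteratedDeriv_sq_mul_zero hfc,
          Nat.factorial_succ, Nat.factorial_succ, show n + (s + 1) = n + 1 + s by ring]
        have : ((2 * s).factorial : ℝ) ≠ 0 := by positivity
        push_cast
        field_simp
        ring
    rw [← hs, Finset.mul_sum, Finset.mul_sum, ← Finset.sum_sub_distrib]
    refine Finset.sum_congr rfl fun s _ => ?_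
    rw [iteratedDeriv_quadratic_mul_zero hfc]
    ring
  rw [hval]
  refine h.congr' ?_
  filter_upwards [self_mem_nhdsWithin] with ε hε
  have hi : ∀ n : ℕ, IntegrableOn (fun x : ℝ =>
      Real.exp (-ε * x) * (x ^ (2 * n + 1) * f x * besselJ (2 * l) x)) (Ioi 0) := fun n =>
    (((polyGrowth_pow _).mul hfp).mul (polyGrowth_besselJ _)).integrableOn_exp_mul hε
  rw [← integral_const_mul, ← integral_const_mul, ← integral_sub ((hi n).const_mul a)
    ((hi (n + 1)).const_mul b)]
  congr 1; ext x; ring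

/-- An Abel mean of an integrable function converges to its integral. -/
lemma tendsto_integral_exp_neg_mul {F : ℝ → ℝ} (hF : IntegrableOn F (Ioi 0)) :
    Tendsto (fun ε : ℝ => ∫ x in Ioi (0 : ℝ), Real.exp (-ε * x) * F x) (𝓝[>] 0)
      (𝓝 (∫ x in Ioi (0 : ℝ), F x)) := by
  refine tendsto_integral_filter_of_dominated_convergence (fun x => ‖F x‖) ?_ ?_ hF.norm ?_
  · refine Eventually.of_forall fun ε => ?_
    exact (Continuous.aestronglyMeasurable (by fun_prop)).mul hF.aestronglyMeasurable
  · filter_upwards [self_mem_nhdsWithin] with ε hε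
    filter_upwards [ae_restrict_mem measurableSet_Ioi] with x hx
    rw [norm_mul, Real.norm_of_nonneg (Real.exp_pos _).le]
    refine mul_le_of_le_one_left (norm_nonneg _) (Real.exp_le_one_iff.2 ?_)
    have h1 : (0 : ℝ) < ε := hε
    have h2 : (0 : ℝ) < x := hx
    nlinarith
  · refine Eventually.of_forall fun x => ?_
    have : Continuous fun ε : ℝ => Real.exp (-ε * x) * F x := by fun_prop
    simpa using (this.tendsto 0).mono_left (nhdsWithin_le_nhds (s := Ioi 0))

lemma HasAbelBesselMoments.integral_eq {l : ℕ} {f : ℝ → ℝ} (hf : HasAbelBesselMoments l f) (n : ℕ)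
    (hi : IntegrableOn (fun x : ℝ => x ^ (2 * n + 1) * f x * besselJ (2 * l) x) (Ioi 0)) :
    ∫ x in Ioi (0 : ℝ), x ^ (2 * n + 1) * f x * besselJ (2 * l) x =
      ∑ s ∈ Finset.range l, (1 / 2) * besselWeight l (n + s) *
        (iteratedDeriv (2 * s) f 0 / (Nat.factorial (2 * s) : ℝ)) :=
  tendsto_nhds_unique (tendsto_integral_exp_neg_mul hi) (hf.2.2 n)

/-! ### Fourier representation of the reciprocal gamma product -/

/-- Cauchy's cosine integral `∫_0^{π/2} cos(θ)^(2 a - 2) cos(2 x θ) dθ`. -/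
noncomputable def cauchyCosIntegral (a x : ℝ) : ℝ :=
  ∫ θ in (0 : ℝ)..Real.pi / 2, Real.cos θ ^ (2 * a - 2) * Real.cos (2 * x * θ)

lemma cos_nonneg_of_mem_Icc_zero_pi_div_two {θ : ℝ} (h : θ ∈ Icc 0 (Real.pi / 2)) :
    0 ≤ Real.cos θ :=
  Real.cos_nonneg_of_mem_Icc ⟨by linarith [h.1, Real.pi_pos], h.2⟩

lemma continuous_cos_rpow {p : ℝ} (hp : 0 ≤ p) : Continuous fun θ : ℝ => Real.cos θ ^ p :=
  Real.continuous_cos.rpow_const fun _ => Or.inr hp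

/-- The antiderivative `F` is the Wronskian `u' v - u v'` of `u = cos^(2a) θ` and `v = cos (2 x θ)`.
It vanishes at both ends, and `u'' v - u v''` combines the two integrands. -/
lemma cauchyCosIntegral_add_one {a : ℝ} (ha : 1 ≤ a) (x : ℝ) :
    (4 * a ^ 2 - 4 * x ^ 2) * cauchyCosIntegral (a + 1) x =
      2 * a * (2 * a - 1) * cauchyCosIntegral a x := by
  set F : ℝ → ℝ := fun θ => -(2 * a) * Real.cos θ ^ (2 * a - 1) * Real.sin θ * Real.cos (2 * x * θ) +
    2 * x * Real.cos θ ^ (2 * a) * Real.sin (2 * x * θ) with hF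
  have hlin : ∀ θ : ℝ, HasDerivAt (fun θ : ℝ => 2 * x * θ) (2 * x) θ := fun θ => by
    simpa using (hasDerivAt_id θ).const_mul (2 * x)
  have hpow : ∀ p : ℝ, 1 ≤ p → ∀ θ : ℝ,
      HasDerivAt (fun θ : ℝ => Real.cos θ ^ p) (-Real.sin θ * p * Real.cos θ ^ (p - 1)) θ :=
    fun p hp θ => (Real.hasDerivAt_cos θ).rpow_const (Or.inr hp)
  have hd : ∀ θ ∈ uIcc (0 : ℝ) (Real.pi / 2), HasDerivAt F
      (2 * a * (2 * a - 1) * (Real.cos θ ^ (2 * a - 2) * Real.cos (2 * x * θ)) -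
        (4 * a ^ 2 - 4 * x ^ 2) *
          (Real.cos θ ^ (2 * (a + 1) - 2) * Real.cos (2 * x * θ))) θ := by
    intro θ hθ
    rw [uIcc_of_le (by positivity)] at hθ
    have hc := cos_nonneg_of_mem_Icc_zero_pi_div_two hθ
    have e1 : Real.cos θ ^ (2 * a) = Real.cos θ ^ (2 * a - 1) * Real.cos θ := by
      rw [← Real.rpow_add_one' hc (by linarith)]; ring_nf
    have e2 : Real.cos θ ^ (2 * a) = Real.cos θ ^ (2 * a - 2) * Real.cos θ ^ 2 := by
      rw [← Real.rpow_natCast, ← Real.rpow_add' hc (by push_cast; linarith)]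
      push_cast; ring_nf
    have e3 : (2 * (a + 1) - 2) = 2 * a := by ring
    have e4 : (2 * a - 1 - 1) = 2 * a - 2 := by ring
    refine (((((hpow (2 * a - 1) (by linarith) θ).const_mul (-(2 * a))).fun_mul
      (Real.hasDerivAt_sin θ)).fun_mul (hlin θ).cos).fun_add
      (((hpow (2 * a) (by linarith) θ).const_mul (2 * x)).fun_mul (hlin θ).sin)).congr_deriv ?_
    rw [e3, e4]
    have e5 : Real.cos θ ^ (2 * a - 2) * Real.sin θ ^ 2 =
        Real.cos θ ^ (2 * a - 2) - Real.cos θ ^ (2 * a) := by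
      rw [e2, Real.sin_sq]; ring
    linear_combination (2 * a) * Real.cos (2 * x * θ) * e1 +
      2 * a * (2 * a - 1) * Real.cos (2 * x * θ) * e5
  have hi : ∀ b : ℝ, 1 ≤ b → IntervalIntegrable
      (fun θ : ℝ => Real.cos θ ^ (2 * b - 2) * Real.cos (2 * x * θ)) volume 0 (Real.pi / 2) :=
    fun b hb => ((continuous_cos_rpow (by linarith)).mul
      (by fun_prop : Continuous fun θ : ℝ => Real.cos (2 * x * θ))).intervalIntegrable _ _
  have key := intervalIntegral.integral_eq_sub_of_hasDerivAt hd
    (((hi a ha).const_mul _).sub ((hi (a + 1) (by linarith)).const_mul _))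
  rw [intervalIntegral.integral_sub ((hi a ha).const_mul _) ((hi (a + 1) (by linarith)).const_mul _),
    intervalIntegral.integral_const_mul, intervalIntegral.integral_const_mul] at key
  have h0 : F 0 = 0 := by simp [hF]
  have h1 : F (Real.pi / 2) = 0 := by
    simp only [hF, Real.cos_pi_div_two]
    rw [Real.zero_rpow (by linarith), Real.zero_rpow (by linarith)]; ring
  rw [h0, h1] at key
  rw [cauchyCosIntegral, cauchyCosIntegral]
  linarith

lemma cauchyCosIntegral_zero_pos {a : ℝ} (ha : 1 ≤ a) : 0 < cauchyCosIntegral a 0 := by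
  rw [cauchyCosIntegral]
  refine intervalIntegral.intervalIntegral_pos_of_pos_on ?_ (fun θ hθ => ?_) (by positivity)
  · exact ((continuous_cos_rpow (by linarith)).mul
      (by fun_prop : Continuous fun θ : ℝ => Real.cos (2 * 0 * θ))).intervalIntegrable _ _
  · simp only [mul_zero, zero_mul, Real.cos_zero, mul_one]
    exact Real.rpow_pos_of_pos (Real.cos_pos_of_mem_Ioo ⟨by linarith [hθ.1, Real.pi_pos], hθ.2⟩) _

/-- The normalised kernels `cos^(2n)` concentrate at `θ = 0`, where the remaining factor equals `1`.
-/
lemma tendsto_cauchyCosIntegral_div {a : ℝ} (ha : 1 ≤ a) (x : ℝ) :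
    Tendsto (fun n : ℕ => cauchyCosIntegral (a + n) x /
      ∫ θ in (0 : ℝ)..Real.pi / 2, Real.cos θ ^ (2 * n)) atTop (𝓝 1) := by
  set f : ℝ → ℝ := fun θ => Real.cos θ ^ (2 * a - 2) * Real.cos (2 * x * θ) with hf
  have hfc : Continuous f := (continuous_cos_rpow (by linarith)).mul
      (by fun_prop : Continuous fun θ : ℝ => Real.cos (2 * x * θ))
  have h := EulerSine.tendsto_integral_cos_pow_mul_div (f := fun θ => (f θ : ℂ))
    (Complex.continuous_ofReal.comp hfc).continuousOn
  have h2 := h.comp (tendsto_id.const_mul_atTop' (two_pos : (0 : ℕ) < 2))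
  have h3 := (Complex.continuous_re.tendsto _).comp h2
  have e0 : ((f 0 : ℝ) : ℂ).re = 1 := by simp [hf]
  rw [e0] at h3
  refine h3.congr fun n => ?_
  simp only [Function.comp_apply, id]
  have e1 : ∀ θ : ℝ, (Real.cos θ : ℂ) ^ (2 * n) * (f θ : ℂ) =
      ((Real.cos θ ^ (2 * n) * f θ : ℝ) : ℂ) := by intro θ; push_cast; ring
  simp only [e1]
  rw [intervalIntegral.integral_ofReal, ← Complex.ofReal_div, Complex.ofReal_re]
  congr 1
  rw [cauchyCosIntegral]
  refine intervalIntegral.integral_congr fun θ hθ => ?_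
  rw [uIcc_of_le (by positivity)] at hθ
  have hc := cos_nonneg_of_mem_Icc_zero_pi_div_two hθ
  have : Real.cos θ ^ (2 * (a + n) - 2) = Real.cos θ ^ (2 * n) * Real.cos θ ^ (2 * a - 2) := by
    rcases Nat.eq_zero_or_pos n with rfl | hn
    · simp
    · have hn' : (1 : ℝ) ≤ n := by exact_mod_cast hn
      rw [← Real.rpow_natCast, ← Real.rpow_add' hc (by push_cast; linarith)]
      push_cast; ring_nf
  simp only [hf, this]
  ring

/-- Iterating the recurrence, divided by its case `x = 0`, peels off one factor at a time; the
remaining quotient at `a + n` tends to `1`. -/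
lemma tendsto_prod_one_sub_div_sq {a : ℝ} (ha : 1 ≤ a) (x : ℝ) :
    Tendsto (fun n : ℕ => ∏ j ∈ Finset.range n, (1 - x ^ 2 / (a + j) ^ 2)) atTop
      (𝓝 (cauchyCosIntegral a x / cauchyCosIntegral a 0)) := by
  have hpos : ∀ n : ℕ, 0 < cauchyCosIntegral (a + n) 0 := fun n =>
    cauchyCosIntegral_zero_pos (by have : (0 : ℝ) ≤ n := n.cast_nonneg; linarith)
  have hstep : ∀ n : ℕ, cauchyCosIntegral a x / cauchyCosIntegral a 0 =
      (∏ j ∈ Finset.range n, (1 - x ^ 2 / (a + j) ^ 2)) *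
        (cauchyCosIntegral (a + n) x / cauchyCosIntegral (a + n) 0) := by
    intro n
    induction n with
    | zero => simp
    | succ n ih =>
      rw [ih, Finset.prod_range_succ, mul_assoc]
      congr 1
      have hn : (0 : ℝ) ≤ n := n.cast_nonneg
      have hb : 1 ≤ a + n := by linarith
      have h1 := cauchyCosIntegral_add_one hb x
      have h2 := cauchyCosIntegral_add_one hb 0
      have h3 := hpos n
      have h4 := hpos (n + 1)
      push_cast at h4 ⊢
      rw [← add_assoc] at h4 ⊢
      set b := a + (n : ℝ) with hbdef
      have hb1 : 0 < 2 * b - 1 := by linarith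
      have hb0 : b ≠ 0 := by positivity
      rw [one_sub_div (by positivity), div_mul_div_comm, div_eq_div_iff h3.ne' (by positivity)]
      have h2' : 4 * b ^ 2 * cauchyCosIntegral (b + 1) 0 =
        2 * b * (2 * b - 1) * cauchyCosIntegral b 0 := by linear_combination h2
      have h5 : (2 * b * (2 * b - 1)) ≠ 0 := by positivity
      refine mul_left_cancel₀ h5 ?_
      linear_combination (cauchyCosIntegral (b + 1) 0 * b ^ 2) * (-h1) +
        (b ^ 2 - x ^ 2) * cauchyCosIntegral (b + 1) x * h2'
  have hlim : Tendsto (fun n : ℕ => cauchyCosIntegral (a + n) x / cauchyCosIntegral (a + n) 0)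
      atTop (𝓝 1) := by
    have h := (tendsto_cauchyCosIntegral_div ha x).div (tendsto_cauchyCosIntegral_div ha 0)
      one_ne_zero
    rw [div_one] at h
    refine h.congr fun n => ?_
    have hW : (0 : ℝ) < ∫ θ in (0 : ℝ)..Real.pi / 2, Real.cos θ ^ (2 * n) :=
      EulerSine.integral_cos_pow_pos _
    simp only [Pi.div_apply]
    rw [div_div_div_cancel_right₀ hW.ne']
  have h := (tendsto_const_nhds (x := cauchyCosIntegral a x / cauchyCosIntegral a 0)).div hlim
    one_ne_zero
  rw [div_one] at h
  refine h.congr' ?_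
  filter_upwards [hlim.eventually_ne one_ne_zero] with n hn
  simp only [Pi.div_apply]
  rw [hstep n, mul_div_cancel_right₀ _ hn]

/-- In Euler's limit for `Γ(a)² / (Γ(a + x) Γ(a - x))` the powers of `n` and the factorials cancel,
leaving the product just evaluated. At a pole one factor of that product is zero, so both sides
vanish. -/
lemma one_div_Gamma_mul_Gamma_eq {a : ℝ} (ha : 1 ≤ a) (x : ℝ) :
    1 / (Real.Gamma (a + x) * Real.Gamma (a - x)) =
      cauchyCosIntegral a x / cauchyCosIntegral a 0 / Real.Gamma a ^ 2 := by
  -- The shift matches `Real.GammaSeq`, whose denominator runs over `j ≤ n`.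
  have hlim := (tendsto_prod_one_sub_div_sq ha x).comp (tendsto_add_atTop_nat 1)
  have haj : ∀ j : ℕ, a + j ≠ 0 := fun j => by positivity
  have hGa : Real.Gamma a ≠ 0 := (Real.Gamma_pos_of_pos (by linarith)).ne'
  have hterm : ∀ j : ℕ, 1 - x ^ 2 / (a + j) ^ 2 = (a + x + j) * (a - x + j) / (a + j) ^ 2 := by
    intro j; have := haj j; field_simp; ring
  by_cases h0 : Real.Gamma (a + x) * Real.Gamma (a - x) = 0
  · rw [h0, div_zero]
    have : ∃ j : ℕ, (a + x + j) * (a - x + j) = 0 := by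
      rcases mul_eq_zero.1 h0 with h | h
      · obtain ⟨j, hj⟩ := (Real.Gamma_eq_zero_iff _).1 h
        exact ⟨j, by rw [hj]; ring⟩
      · obtain ⟨j, hj⟩ := (Real.Gamma_eq_zero_iff _).1 h
        exact ⟨j, by rw [hj]; ring⟩
    obtain ⟨j, hj⟩ := this
    have hz : Tendsto (fun _ : ℕ => (0 : ℝ)) atTop
        (𝓝 (cauchyCosIntegral a x / cauchyCosIntegral a 0)) := by
      refine hlim.congr' ?_
      filter_upwards [eventually_ge_atTop j] with n hn
      exact Finset.prod_eq_zero (i := j) (Finset.mem_range.2 (Nat.lt_succ_of_le hn)) (by rw [hterm, hj, zero_div])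
    rw [tendsto_nhds_unique hz tendsto_const_nhds, zero_div]
  · have h1 := (((Real.GammaSeq_tendsto_Gamma a).pow 2).div ((Real.GammaSeq_tendsto_Gamma (a + x)).mul
      (Real.GammaSeq_tendsto_Gamma (a - x))) h0)
    have h2 := tendsto_nhds_unique (h1.congr' ?_) hlim
    · rw [← h2]; field_simp
    · filter_upwards [eventually_gt_atTop 0] with n hn
      have hn' : (0 : ℝ) < n := by exact_mod_cast hn
      simp only [Pi.div_apply, Function.comp_apply, Real.GammaSeq]
      simp only [hterm]
      rw [Finset.prod_div_distrib, Finset.prod_mul_distrib, Finset.prod_pow, div_pow,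
        div_mul_div_comm]
      have e : ((n : ℝ) ^ (a + x) * n.factorial) * ((n : ℝ) ^ (a - x) * n.factorial) =
          ((n : ℝ) ^ a * n.factorial) ^ 2 := by
        rw [mul_mul_mul_comm, ← Real.rpow_add hn', mul_pow, ← Real.rpow_natCast ((n : ℝ) ^ a),
          ← Real.rpow_mul hn'.le]
        push_cast; ring_nf
      rw [e]
      have : ((n : ℝ) ^ a * n.factorial) ^ 2 ≠ 0 := by positivity
      rw [div_div_div_cancel_left' _ _ this]

/-- The convention `Γ(0) = 0` makes this valid at `s = 0` too, so the shift in `a` below needs no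
exceptions at poles. -/
lemma Real.inv_Gamma_eq_mul (s : ℝ) : (Real.Gamma s)⁻¹ = s * (Real.Gamma (s + 1))⁻¹ := by
  rcases eq_or_ne s 0 with rfl | h
  · simp [Real.Gamma_zero]
  · rw [Real.Gamma_add_one h, mul_inv, mul_inv_cancel_left₀ h]

lemma one_div_Gamma_mul_Gamma_shift (a x : ℝ) :
    1 / (Real.Gamma (a + x) * Real.Gamma (a - x)) =
      (a ^ 2 - x ^ 2) * (1 / (Real.Gamma (a + 1 + x) * Real.Gamma (a + 1 - x))) := by
  rw [one_div, mul_inv, Real.inv_Gamma_eq_mul (a + x), Real.inv_Gamma_eq_mul (a - x), one_div,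
    mul_inv, show a + x + 1 = a + 1 + x by ring, show a - x + 1 = a + 1 - x by ring]
  ring

/-! ### Band-limited functions -/

/-- A cosine is half the sum of two exponentials, so the measure is the sum of the images of the
density `w / 2` under `θ ↦ ± c θ`. -/
lemma isBandLimited_integral_mul_cos {w : ℝ → ℝ} {b c : ℝ} (hc : 0 ≤ c)
    (hw : IntegrableOn w (Icc 0 b)) (hw0 : ∀ θ ∈ Icc 0 b, 0 ≤ w θ) :
    IsBandLimited (c * b) fun x => ∫ θ in Icc 0 b, w θ * Real.cos (c * x * θ) := by
  have hw2 : Integrable (fun θ => w θ / 2) (volume.restrict (Icc 0 b)) := hw.div_const 2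
  set ν := (volume.restrict (Icc 0 b)).withDensity fun θ => ENNReal.ofReal (w θ / 2) with hν
  have hfin : IsFiniteMeasure ν := isFiniteMeasure_withDensity_ofReal hw2.2
  have hsupp : ∀ᵐ θ ∂ν, θ ∈ Icc 0 b :=
    (withDensity_absolutelyContinuous _ _).ae_le (ae_restrict_mem measurableSet_Icc)
  have hchar : ∀ y : ℝ, charFun ν y =
      ∫ θ in Icc 0 b, ((w θ / 2 : ℝ) : ℂ) * Complex.exp (y * θ * Complex.I) := by
    intro y
    rw [charFun_apply_real, hν, integral_withDensity_eq_integral_toReal_smul₀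
      hw2.aestronglyMeasurable.aemeasurable.ennreal_ofReal (by simp)]
    refine setIntegral_congr_fun measurableSet_Icc fun θ hθ => ?_
    rw [ENNReal.toReal_ofReal (by linarith [hw0 θ hθ]), Complex.real_smul]
  have hint : ∀ y : ℝ, Integrable (fun θ : ℝ => ((w θ / 2 : ℝ) : ℂ) *
      Complex.exp (y * θ * Complex.I)) (volume.restrict (Icc 0 b)) := by
    intro y
    refine hw2.ofReal.mul_bdd (c := 1) (Continuous.aestronglyMeasurable (by fun_prop))
      (Eventually.of_forall fun θ => ?_)
    rw [show (y : ℂ) * θ * Complex.I = ((y * θ : ℝ) : ℂ) * Complex.I by push_cast; ring,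
        Complex.norm_exp_ofReal_mul_I]
  have hm : ∀ r : ℝ, IsFiniteMeasure (ν.map (r * ·)) := fun r => Measure.isFiniteMeasure_map ν _
  have := hm c
  have := hm (-c)
  refine ⟨ν.map (c * ·) + ν.map (-c * ·), inferInstance, ?_, fun x => ?_⟩
  · rw [ae_add_measure_iff]
    have hms : MeasurableSet {t : ℝ | |t| ≤ c * b} := measurableSet_le (by fun_prop) (by fun_prop)
    constructor
    · rw [ae_map_iff (by fun_prop) hms]
      filter_upwards [hsupp] with θ hθ
      rw [abs_mul, abs_of_nonneg hc, abs_of_nonneg hθ.1]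
      exact mul_le_mul_of_nonneg_left hθ.2 hc
    · rw [ae_map_iff (by fun_prop) hms]
      filter_upwards [hsupp] with θ hθ
      rw [abs_mul, abs_neg, abs_of_nonneg hc, abs_of_nonneg hθ.1]
      exact mul_le_mul_of_nonneg_left hθ.2 hc
  · have hexp : ∀ r : ℝ, Integrable (fun t : ℝ => Complex.exp (x * t * Complex.I))
        (ν.map (r * ·)) := by
      intro r
      have := hm r
      refine Integrable.of_bound (Continuous.aestronglyMeasurable (by fun_prop)) 1
        (Eventually.of_forall fun t => ?_)
      rw [show (x : ℂ) * t * Complex.I = ((x * t : ℝ) : ℂ) * Complex.I by push_cast; ring,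
        Complex.norm_exp_ofReal_mul_I]
    rw [charFun_apply_real, integral_add_measure (hexp c) (hexp (-c)), ← charFun_apply_real,
      ← charFun_apply_real, charFun_map_mul, charFun_map_mul, hchar, hchar,
      ← integral_add (hint _) (hint _), ← integral_complex_ofReal]
    congr 1; ext θ
    push_cast
    rw [Complex.cos]
    ring_nf

lemma IsBandLimited.const_mul {σ : ℝ} {f : ℝ → ℝ} (hf : IsBandLimited σ f) {c : ℝ} (hc : 0 ≤ c) :
    IsBandLimited σ fun x => c * f x := by
  obtain ⟨μ, hμ, hσ, h⟩ := hf
  refine ⟨ENNReal.ofReal c • μ, μ.smul_finite ENNReal.ofReal_ne_top,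
    Measure.ae_smul_measure hσ _, fun x => ?_⟩
  rw [charFun_apply_real, integral_smul_measure, ← charFun_apply_real, h,
    ENNReal.toReal_ofReal hc, Complex.real_smul]
  push_cast; rfl

lemma isBandLimited_one : IsBandLimited 0 fun _ => 1 :=
  ⟨Measure.dirac 0, inferInstance, by simp [ae_dirac_eq], fun x => by simp [charFun_dirac]⟩

/-- Products correspond to convolutions of measures, whose supports add. -/
lemma IsBandLimited.mul {σ τ : ℝ} {f g : ℝ → ℝ} (hf : IsBandLimited σ f) (hg : IsBandLimited τ g) :
    IsBandLimited (σ + τ) fun x => f x * g x := by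
  obtain ⟨μ, hμ, hσ, h⟩ := hf
  obtain ⟨ν, hν, hτ, h'⟩ := hg
  refine ⟨μ.conv ν, inferInstance, ?_, fun x => ?_⟩
  · rw [Measure.conv, ae_map_iff (by fun_prop)
      (measurableSet_le (by fun_prop) (by fun_prop))]
    have h1 : ∀ᵐ p ∂μ.prod ν, |p.1| ≤ σ := Measure.quasiMeasurePreserving_fst.ae hσ
    have h2 : ∀ᵐ p ∂μ.prod ν, |p.2| ≤ τ := Measure.quasiMeasurePreserving_snd.ae hτ
    filter_upwards [h1, h2] with p hp1 hp2
    exact (abs_add_le _ _).trans (add_le_add hp1 hp2)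
  · rw [charFun_conv, h, h']; push_cast; rfl

lemma isBandLimited_prod {ι : Type*} (s : Finset ι) {σ : ι → ℝ} {f : ι → ℝ → ℝ}
    (h : ∀ i ∈ s, IsBandLimited (σ i) (f i)) :
    IsBandLimited (∑ i ∈ s, σ i) fun x => ∏ i ∈ s, f i x := by
  classical
  induction s using Finset.induction_on with
  | empty => simpa using isBandLimited_one
  | insert i s hi ih =>
    simp only [Finset.prod_insert hi, Finset.sum_insert hi]
    exact (h i (Finset.mem_insert_self i s)).mul
      (ih fun j hj => h j (Finset.mem_insert_of_mem hj))

lemma isBandLimited_one_div_Gamma_mul_Gamma {a b : ℝ} (ha : 1 ≤ a) (hb : 0 ≤ b) :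
    IsBandLimited (Real.pi * b)
      fun x => 1 / (Real.Gamma (a + b * x) * Real.Gamma (a - b * x)) := by
  have h := (isBandLimited_integral_mul_cos (w := fun θ => Real.cos θ ^ (2 * a - 2))
    (b := Real.pi / 2) (c := 2 * b) (by positivity)
    (continuous_cos_rpow (by linarith)).integrableOn_Icc
    (fun θ hθ => Real.rpow_nonneg (cos_nonneg_of_mem_Icc_zero_pi_div_two hθ) _)).const_mul
    (c := 1 / (cauchyCosIntegral a 0 * Real.Gamma a ^ 2))
    (by have := cauchyCosIntegral_zero_pos ha; positivity)
  have e : 2 * b * (Real.pi / 2) = Real.pi * b := by ring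
  rw [e] at h
  convert h using 2 with x
  rw [one_div_Gamma_mul_Gamma_eq ha, cauchyCosIntegral,
    intervalIntegral.integral_of_le (by positivity), ← integral_Icc_eq_integral_Ioc,
    div_div, div_eq_mul_one_div, mul_comm]
  simp only [mul_assoc]

lemma HasAbelBesselMoments.prod_quadratic_mul {l : ℕ} {f : ℝ → ℝ} (hf : HasAbelBesselMoments l f)
    {ι : Type*} (s : Finset ι) (a b : ι → ℝ) :
    HasAbelBesselMoments l fun x => (∏ i ∈ s, (a i - b i * x ^ 2)) * f x := by
  classical
  induction s using Finset.induction_on with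
  | empty => simpa using hf
  | insert i s hi ih =>
    simp only [Finset.prod_insert hi, mul_assoc]
    exact ih.quadratic_mul (a i) (b i)

/-- Cauchy's integral is available only for parameters at least `1`; for `α k > 0` the shift to `α k
+ 1` costs one quadratic factor each. -/
lemma recipGammaProd_eq_prod_mul {M : ℕ} (α β : Fin M → ℝ) (x : ℝ) :
    recipGammaProd α β x = (∏ k, (α k ^ 2 - β k ^ 2 * x ^ 2)) *
      ∏ k, 1 / (Real.Gamma (α k + 1 + β k * x) * Real.Gamma (α k + 1 - β k * x)) := by
  rw [recipGammaProd, one_div, ← Finset.prod_inv_distrib, ← Finset.prod_mul_distrib]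
  refine Finset.prod_congr rfl fun k _ => ?_
  rw [← one_div, one_div_Gamma_mul_Gamma_shift, mul_pow]

lemma isBandLimited_prod_one_div_Gamma {M : ℕ} {α β : Fin M → ℝ}
    (hα : ∀ k, 0 < α k) (hβ : ∀ k, 0 < β k) : IsBandLimited (Real.pi * ∑ k, β k) fun x =>
      ∏ k, 1 / (Real.Gamma (α k + 1 + β k * x) * Real.Gamma (α k + 1 - β k * x)) := by
  rw [Finset.mul_sum]
  exact isBandLimited_prod _ fun k _ =>
    isBandLimited_one_div_Gamma_mul_Gamma (by linarith [hα k]) (hβ k).le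

lemma hasAbelBesselMoments_recipGammaProd {M : ℕ} {α β : Fin M → ℝ}
    (hα : ∀ k, 0 < α k) (hβ : ∀ k, 0 < β k) (h1 : Real.pi * ∑ k, β k < 1) (l : ℕ) :
    HasAbelBesselMoments l (recipGammaProd α β) := by
  have h := ((isBandLimited_prod_one_div_Gamma hα hβ).hasAbelBesselMoments h1 l).prod_quadratic_mul
    Finset.univ (fun k => α k ^ 2) (fun k => β k ^ 2)
  simpa only [← recipGammaProd_eq_prod_mul] using h

lemma contDiff_recipGammaProd {M : ℕ} {α β : Fin M → ℝ}
    (hα : ∀ k, 0 < α k) (hβ : ∀ k, 0 < β k) (n : ℕ) : ContDiff ℝ n (recipGammaProd α β) := by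
  rw [funext (recipGammaProd_eq_prod_mul α β)]
  refine ContDiff.mul ?_ ((isBandLimited_prod_one_div_Gamma hα hβ).contDiff n)
  exact contDiff_prod fun k _ => contDiff_const.sub (contDiff_const.mul (contDiff_id.pow 2))

/-! ### Decay of the reciprocal gamma product -/

/-- Log-convexity of `Γ` between `y` and `y + 1`. -/
lemma Gamma_add_le_rpow_mul_of_mem_Icc {c : ℝ} (hc : c ∈ Icc (0 : ℝ) 1) {y : ℝ} (hy : 0 < y) :
    Real.Gamma (y + c) ≤ y ^ c * Real.Gamma y := by
  have hG := Real.Gamma_pos_of_pos hy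
  rcases eq_or_lt_of_le hc.1 with rfl | h0
  · simp
  rcases eq_or_lt_of_le hc.2 with rfl | h1
  · rw [Real.Gamma_add_one hy.ne', Real.rpow_one]
  have h := Real.Gamma_mul_add_mul_le_rpow_Gamma_mul_rpow_Gamma hy (by linarith : 0 < y + 1)
    (by linarith : 0 < 1 - c) h0 (by ring)
  rw [Real.Gamma_add_one hy.ne', Real.mul_rpow hy.le hG.le] at h
  calc Real.Gamma (y + c) = Real.Gamma ((1 - c) * y + c * (y + 1)) := by ring_nf
    _ ≤ _ := h
    _ = y ^ c * (Real.Gamma y ^ (1 - c) * Real.Gamma y ^ c) := by ring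
    _ = _ := by rw [← Real.rpow_add hG]; simp

/-- The upper bound `Γ(y + c) = O(y ^ c Γ(y))` for large `y`. -/
lemma exists_Gamma_add_le (c : ℝ) :
    ∃ C Y : ℝ, 0 < C ∧ 0 < Y ∧ ∀ y : ℝ, Y ≤ y → Real.Gamma (y + c) ≤ C * (y ^ c * Real.Gamma y) := by
  have key : ∀ (n : ℤ) (c : ℝ), c ∈ Icc (0 : ℝ) 1 → ∃ C Y : ℝ, 0 < C ∧ 0 < Y ∧
      ∀ y : ℝ, Y ≤ y → Real.Gamma (y + (n + c)) ≤ C * (y ^ (n + c) * Real.Gamma y) := by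
    intro n c hc
    induction n using Int.induction_on with
    | zero =>
      refine ⟨1, 1, one_pos, one_pos, fun y hy => ?_⟩
      simpa using Gamma_add_le_rpow_mul_of_mem_Icc hc (by linarith : 0 < y)
    | succ n ih =>
      obtain ⟨C, Y, hC, hY, h⟩ := ih
      set d : ℝ := ((n : ℤ) : ℝ) + c with hd
      -- The threshold ensures `0 < y + d ≤ 2 y`.
      refine ⟨2 * C, Y + |d| + 1, by positivity, by positivity, fun y hy => ?_⟩
      have hd1 := neg_abs_le d
      have hd2 := le_abs_self d
      have hy0 : 0 < y := by linarith [abs_nonneg d]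
      have e : (((n : ℤ) + 1 : ℤ) : ℝ) + c = d + 1 := by rw [hd]; push_cast; ring
      rw [e, ← add_assoc, Real.Gamma_add_one (by linarith), Real.rpow_add_one hy0.ne']
      have h' := h y (by linarith [abs_nonneg d])
      have hGp := Real.Gamma_pos_of_pos hy0
      calc (y + d) * Real.Gamma (y + d) ≤ (2 * y) * (C * (y ^ d * Real.Gamma y)) := by
            apply mul_le_mul _ h' (Real.Gamma_pos_of_pos (by linarith)).le (by positivity)
            linarith
        _ = _ := by ring
    | pred n ih =>
      obtain ⟨C, Y, hC, hY, h⟩ := ih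
      set d : ℝ := ((-(n : ℤ) : ℤ) : ℝ) + c with hd
      -- The threshold ensures `y + (d - 1) ≥ y / 2`, so the functional equation can be divided by
      -- this factor.
      refine ⟨2 * C, Y + 2 * |d - 1| + 1, by positivity, by positivity, fun y hy => ?_⟩
      have hd1 := neg_abs_le (d - 1)
      have hy0 : 0 < y := by linarith [abs_nonneg (d - 1)]
      have e : ((-(n : ℤ) - 1 : ℤ) : ℝ) + c = d - 1 := by rw [hd]; push_cast; ring
      rw [e]
      have hpos : 0 < y + (d - 1) := by linarith [abs_nonneg (d - 1)]
      have h1 := Real.Gamma_add_one hpos.ne'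
      rw [show y + (d - 1) + 1 = y + d by ring] at h1
      have h' := h y (by linarith [abs_nonneg (d - 1)])
      have hGp := Real.Gamma_pos_of_pos hy0
      rw [h1] at h'
      have hG2 := Real.Gamma_pos_of_pos hpos
      rw [Real.rpow_sub_one hy0.ne']
      have h2 : y / 2 * Real.Gamma (y + (d - 1)) ≤ C * (y ^ d * Real.Gamma y) :=
        (mul_le_mul_of_nonneg_right (by linarith) hG2.le).trans h'
      have h3 : 2 * C * (y ^ d / y * Real.Gamma y) = C * (y ^ d * Real.Gamma y) / (y / 2) := by
        field_simp
      rw [h3, le_div_iff₀ (by positivity)]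
      linarith
  have := key ⌊c⌋ (Int.fract c) ⟨Int.fract_nonneg c, (Int.fract_lt_one c).le⟩
  simpa only [Int.floor_add_fract] using this

lemma exists_add_mul_rpow_le {A b : ℝ} (hA : 0 < A) (hb : 0 < b) (p : ℝ) :
    ∃ C : ℝ, 0 < C ∧ ∀ x : ℝ, 0 ≤ x → (A + b * x) ^ p ≤ C * (1 + x) ^ p := by
  rcases le_total 0 p with hp | hp
  · refine ⟨max A b ^ p, Real.rpow_pos_of_pos (lt_max_of_lt_left hA) p, fun x hx => ?_⟩
    rw [← Real.mul_rpow (le_max_of_le_left hA.le) (by linarith)]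
    refine Real.rpow_le_rpow (by positivity) ?_ hp
    nlinarith [le_max_left A b, mul_le_mul_of_nonneg_right (le_max_right A b) hx]
  · refine ⟨min A b ^ p, Real.rpow_pos_of_pos (lt_min hA hb) p, fun x hx => ?_⟩
    have hm : 0 < min A b := lt_min hA hb
    rw [← Real.mul_rpow hm.le (by linarith)]
    refine Real.rpow_le_rpow_of_nonpos (by positivity) ?_ hp
    nlinarith [min_le_left A b, mul_le_mul_of_nonneg_right (min_le_right A b) hx]

lemma abs_inv_Gamma_sub_le {a y : ℝ} (hy : 0 < 1 - a + y) :
    |(Real.Gamma (a - y))⁻¹| ≤ Real.Gamma (1 - a + y) := by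
  have hG := Real.Gamma_pos_of_pos hy
  have h := Real.Gamma_mul_Gamma_one_sub (a - y)
  rw [show 1 - (a - y) = 1 - a + y by ring] at h
  have h2 : (Real.Gamma (a - y))⁻¹ =
      Real.Gamma (1 - a + y) * (Real.sin (Real.pi * (a - y)) / Real.pi) := by
    have h3 := congrArg (·⁻¹) h
    simp only [mul_inv, inv_div] at h3
    rw [← h3]
    field_simp
  rw [h2, abs_mul, abs_of_pos hG]
  refine mul_le_of_le_one_right hG.le ?_
  rw [abs_div, abs_of_pos Real.pi_pos, div_le_one Real.pi_pos]
  linarith [Real.abs_sin_le_one (Real.pi * (a - y)), Real.pi_gt_three]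

/-- For large `y`, reflection bounds `|1 / Γ(a - y)|` by `Γ(1 - a + y)`, and the quotient by `Γ(a +
y)` is of order `y^(1 - 2a)`. The remaining compact range is handled by continuity. -/
lemma exists_abs_one_div_Gamma_mul_Gamma_le {a : ℝ} (ha : 0 < a) :
    ∃ C : ℝ, 0 < C ∧ ∀ y : ℝ, 0 ≤ y →
      |1 / (Real.Gamma (a + y) * Real.Gamma (a - y))| ≤ C * (1 + y) ^ (1 - 2 * a) := by
  obtain ⟨C, Y, hC, hY, h⟩ := exists_Gamma_add_le (1 - 2 * a)
  obtain ⟨D, hD, hD'⟩ := exists_add_mul_rpow_le ha one_pos (1 - 2 * a)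
  have hcont : Continuous fun y : ℝ => 1 / (Real.Gamma (a + y) * Real.Gamma (a - y)) := by
    have h1 := contDiff_zero.1 (by exact_mod_cast (isBandLimited_one_div_Gamma_mul_Gamma
      (a := a + 1) (by linarith) zero_le_one).contDiff 0)
    rw [funext (one_div_Gamma_mul_Gamma_shift a)]
    simp only [one_mul] at h1
    exact (by fun_prop : Continuous fun y : ℝ => a ^ 2 - y ^ 2).mul h1
  have hcont2 : ContinuousOn (fun y : ℝ => 1 / (Real.Gamma (a + y) * Real.Gamma (a - y)) *
      (1 + y) ^ (-(1 - 2 * a))) (Icc 0 (Y + a)) := by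
    refine hcont.continuousOn.mul (ContinuousOn.rpow_const (by fun_prop) fun y hy => Or.inl ?_)
    have := hy.1
    positivity
  obtain ⟨B, hB⟩ := isCompact_Icc.exists_bound_of_continuousOn hcont2
  refine ⟨|B| + C * D, by positivity, fun y hy => ?_⟩
  have h1y : 0 < (1 + y) ^ (1 - 2 * a) := Real.rpow_pos_of_pos (by linarith) _
  rcases le_total y (Y + a) with hyY | hyY
  · have := hB y ⟨hy, hyY⟩
    rw [norm_mul, Real.norm_eq_abs, Real.rpow_neg (by linarith), norm_inv,
      Real.norm_of_nonneg h1y.le, ← div_eq_mul_inv, div_le_iff₀ h1y] at this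
    refine this.trans ?_
    gcongr
    exact (le_abs_self B).trans (le_add_of_nonneg_right (by positivity))
  · have hG := Real.Gamma_pos_of_pos (by linarith : 0 < a + y)
    have h2 := abs_inv_Gamma_sub_le (a := a) (y := y) (by linarith)
    have h3 := h (a + y) (by linarith)
    rw [show a + y + (1 - 2 * a) = 1 - a + y by ring] at h3
    have h4 := hD' y hy
    rw [one_mul] at h4
    rw [one_div, mul_inv, abs_mul, abs_inv, abs_of_pos hG]
    calc (Real.Gamma (a + y))⁻¹ * |(Real.Gamma (a - y))⁻¹|
        ≤ (Real.Gamma (a + y))⁻¹ * (C * ((a + y) ^ (1 - 2 * a) * Real.Gamma (a + y))) := by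
          gcongr; exact h2.trans h3
      _ = C * (a + y) ^ (1 - 2 * a) := by field_simp
      _ ≤ C * (D * (1 + y) ^ (1 - 2 * a)) := by gcongr
      _ ≤ (|B| + C * D) * (1 + y) ^ (1 - 2 * a) := by
          rw [← mul_assoc]; gcongr; linarith [abs_nonneg B]

lemma exists_abs_recipGammaProd_le {M : ℕ} {α β : Fin M → ℝ}
    (hα : ∀ k, 0 < α k) (hβ : ∀ k, 0 < β k) :
    ∃ C : ℝ, 0 < C ∧ ∀ x : ℝ, 0 ≤ x →
      |recipGammaProd α β x| ≤ C * (1 + x) ^ ((M : ℝ) - 2 * ∑ k, α k) := by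
  have hfac : ∀ k, ∃ C : ℝ, 0 < C ∧ ∀ x : ℝ, 0 ≤ x →
      |1 / (Real.Gamma (α k + β k * x) * Real.Gamma (α k - β k * x))| ≤
        C * (1 + x) ^ (1 - 2 * α k) := by
    intro k
    obtain ⟨C, hC, h⟩ := exists_abs_one_div_Gamma_mul_Gamma_le (hα k)
    obtain ⟨D, hD, h'⟩ := exists_add_mul_rpow_le one_pos (hβ k) (1 - 2 * α k)
    refine ⟨C * D, by positivity, fun x hx => ?_⟩
    calc _ ≤ C * (1 + β k * x) ^ (1 - 2 * α k) := h _ (mul_nonneg (hβ k).le hx)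
      _ ≤ C * (D * (1 + x) ^ (1 - 2 * α k)) := by gcongr; exact h' x hx
      _ = _ := by ring
  choose C hC h using hfac
  refine ⟨∏ k, C k, Finset.prod_pos fun k _ => hC k, fun x hx => ?_⟩
  have e : (M : ℝ) - 2 * ∑ k, α k = ∑ k, (1 - 2 * α k) := by
    rw [Finset.sum_sub_distrib, Finset.mul_sum]; simp
  rw [e, Real.rpow_sum_of_pos (by linarith), ← Finset.prod_mul_distrib, recipGammaProd, one_div,
    ← Finset.prod_inv_distrib, Finset.abs_prod]
  refine Finset.prod_le_prod (fun k _ => abs_nonneg _) fun k _ => ?_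
  rw [← one_div]
  exact h k x hx

/-! ### The integral -/

lemma integrableOn_pow_mul_recipGammaProd_mul_rpow {M m : ℕ} {α β : Fin M → ℝ} {lam : ℝ}
    (hα : ∀ k, 0 < α k) (hβ : ∀ k, 0 < β k)
    (hsum : (m : ℝ) + (1 / 2) * ((M : ℝ) + 3 / 2) < ∑ k, α k) (hlam : 0 < lam) :
    IntegrableOn (fun x : ℝ =>
      x ^ (2 * m + 1) * recipGammaProd α β x * (1 + lam * x) ^ (-(1 / 2) : ℝ)) (Ioi 0) := by
  obtain ⟨C, hC, h⟩ := exists_abs_recipGammaProd_le hα hβ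
  obtain ⟨D, hD, h'⟩ := exists_add_mul_rpow_le one_pos hlam (-(1 / 2))
  set e : ℝ := (2 * m + 1 : ℕ) + ((M : ℝ) - 2 * ∑ k, α k) + -(1 / 2) with he
  have hint : IntegrableOn (fun x : ℝ => C * D * (x + 1) ^ e) (Ioi 0) :=
    -- The condition `e < -1` is precisely the hypothesis on `∑ α`.
    (integrableOn_add_rpow_Ioi_of_lt (by rw [he]; push_cast; linarith) (by norm_num)).const_mul _
  have hgc : Continuous (recipGammaProd α β) :=
    contDiff_zero.1 (by exact_mod_cast contDiff_recipGammaProd hα hβ 0)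
  refine Integrable.mono' hint ?_ ?_
  · refine ContinuousOn.aestronglyMeasurable ?_ measurableSet_Ioi
    refine ((continuous_pow _).mul hgc).continuousOn.mul
      (ContinuousOn.rpow_const (by fun_prop) fun x hx => Or.inl ?_)
    have : (0 : ℝ) < x := hx
    positivity
  · filter_upwards [ae_restrict_mem measurableSet_Ioi] with x hx
    have hx0 : (0 : ℝ) < x := hx
    have h1 : (0 : ℝ) < 1 + x := by linarith
    rw [norm_mul, norm_mul, norm_pow, Real.norm_of_nonneg hx0.le, Real.norm_eq_abs,
      Real.norm_of_nonneg (Real.rpow_nonneg (by positivity) _)]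
    calc x ^ (2 * m + 1) * |recipGammaProd α β x| * (1 + lam * x) ^ (-(1 / 2) : ℝ)
        ≤ (1 + x) ^ (2 * m + 1) * (C * (1 + x) ^ ((M : ℝ) - 2 * ∑ k, α k)) *
          (D * (1 + x) ^ (-(1 / 2) : ℝ)) := by
          gcongr
          · linarith
          · exact h x hx0.le
          · exact h' x hx0.le
      _ = C * D * (x + 1) ^ e := by
          rw [he, add_comm x 1, Real.rpow_add h1, Real.rpow_add h1, Real.rpow_natCast]; ring

lemma integrableOn_pow_mul_recipGammaProd_mul_besselJ {M m : ℕ} (l : ℕ) {α β : Fin M → ℝ} {lam : ℝ}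
    (hα : ∀ k, 0 < α k) (hβ : ∀ k, 0 < β k)
    (hsum : (m : ℝ) + (1 / 2) * ((M : ℝ) + 3 / 2) < ∑ k, α k) (hlam : 0 < lam) :
    IntegrableOn (fun x : ℝ =>
      x ^ (2 * m + 1) * recipGammaProd α β x * besselJ (2 * l) (lam * x)) (Ioi 0) := by
  obtain ⟨C, hC, h⟩ := exists_abs_besselJ_le (2 * l)
  have hgc : Continuous (recipGammaProd α β) :=
    contDiff_zero.1 (by exact_mod_cast contDiff_recipGammaProd hα hβ 0)
  have hJ := continuous_besselJ (2 * l)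
  refine Integrable.mono' ((integrableOn_pow_mul_recipGammaProd_mul_rpow hα hβ hsum
    hlam).norm.const_mul C) (Continuous.aestronglyMeasurable (by fun_prop)) ?_
  filter_upwards [ae_restrict_mem measurableSet_Ioi] with x hx
  have hx0 : (0 : ℝ) < x := hx
  rw [norm_mul, norm_mul _ ((1 + lam * x) ^ (-(1 / 2) : ℝ)),
    Real.norm_of_nonneg (Real.rpow_nonneg (by positivity) _)]
  calc _ ≤ ‖x ^ (2 * m + 1) * recipGammaProd α β x‖ * (C * (1 + lam * x) ^ (-(1 / 2) : ℝ)) := by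
        gcongr; exact h _ (by positivity)
    _ = _ := by ring

/-- For `r > lam` the decay bound at `r x` is below that at `lam x`, so one majorant serves all `r`.
-/
lemma tendsto_integral_pow_mul_recipGammaProd_mul_besselJ {M m : ℕ} (l : ℕ) {α β : Fin M → ℝ}
    {lam : ℝ} (hα : ∀ k, 0 < α k) (hβ : ∀ k, 0 < β k)
    (hsum : (m : ℝ) + (1 / 2) * ((M : ℝ) + 3 / 2) < ∑ k, α k) (hlam : 0 < lam) :
    Tendsto (fun r : ℝ => ∫ x in Ioi (0 : ℝ),
        x ^ (2 * m + 1) * recipGammaProd α β x * besselJ (2 * l) (r * x)) (𝓝[>] lam)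
      (𝓝 (∫ x in Ioi (0 : ℝ),
        x ^ (2 * m + 1) * recipGammaProd α β x * besselJ (2 * l) (lam * x))) := by
  obtain ⟨C, hC, h⟩ := exists_abs_besselJ_le (2 * l)
  have hgc : Continuous (recipGammaProd α β) :=
    contDiff_zero.1 (by exact_mod_cast contDiff_recipGammaProd hα hβ 0)
  have hJ := continuous_besselJ (2 * l)
  refine tendsto_integral_filter_of_dominated_convergence _ ?_ ?_
    ((integrableOn_pow_mul_recipGammaProd_mul_rpow hα hβ hsum hlam).norm.const_mul C) ?_
  · exact Eventually.of_forall fun r => Continuous.aestronglyMeasurable (by fun_prop)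
  · filter_upwards [self_mem_nhdsWithin] with r hr
    filter_upwards [ae_restrict_mem measurableSet_Ioi] with x hx
    have hx0 : (0 : ℝ) < x := hx
    have hr0 : lam < r := hr
    rw [norm_mul, norm_mul _ ((1 + lam * x) ^ (-(1 / 2) : ℝ)),
      Real.norm_of_nonneg (Real.rpow_nonneg (by positivity) _)]
    have h1 : |besselJ (2 * l) (r * x)| ≤ C * (1 + lam * x) ^ (-(1 / 2) : ℝ) := by
      refine (h _ (mul_nonneg (hlam.trans hr0).le hx0.le)).trans ?_
      exact mul_le_mul_of_nonneg_left (Real.rpow_le_rpow_of_nonpos (by positivity)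
        (by gcongr) (by norm_num)) hC.le
    calc _ ≤ ‖x ^ (2 * m + 1) * recipGammaProd α β x‖ * (C * (1 + lam * x) ^ (-(1 / 2) : ℝ)) := by
          gcongr; exact h1
      _ = _ := by ring
  · refine Eventually.of_forall fun x => ?_
    have : Continuous fun r : ℝ =>
        x ^ (2 * m + 1) * recipGammaProd α β x * besselJ (2 * l) (r * x) := by fun_prop
    exact (this.tendsto lam).mono_left nhdsWithin_le_nhds

/-- The integral formula in the interior `λ > π ∑ β` of the range of `λ`. -/
lemma integral_pow_mul_recipGammaProd_mul_besselJ_of_lt {M m : ℕ} (l : ℕ) {α β : Fin M → ℝ}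
    {lam : ℝ} (hα : ∀ k, 0 < α k) (hβ : ∀ k, 0 < β k)
    (hsum : (m : ℝ) + (1 / 2) * ((M : ℝ) + 3 / 2) < ∑ k, α k) (hlam : 0 < lam)
    (hlt : Real.pi * ∑ k, β k < lam) :
    ∫ x in Ioi (0 : ℝ), x ^ (2 * m + 1) * recipGammaProd α β x * besselJ (2 * l) (lam * x) =
      ∑ s ∈ Finset.range l, (1 / 2) * besselWeight l (m + s) *
        (recipGammaCoeff α β s / (Nat.factorial (2 * s) : ℝ)) * (1 / lam) ^ (2 * (m + s + 1)) := by
  -- Rescaling `x` by `lam` reduces to argument `x` in the Bessel function, with band strictly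
  -- inside `(-1, 1)`.
  set γ : Fin M → ℝ := fun k => β k / lam with hγ
  have hγ0 : ∀ k, 0 < γ k := fun k => div_pos (hβ k) hlam
  have hγ1 : Real.pi * ∑ k, γ k < 1 := by
    rw [hγ, ← Finset.sum_div, ← mul_div_assoc, div_lt_one hlam]; exact hlt
  have hscale : recipGammaProd α γ = fun x => recipGammaProd α β (lam⁻¹ * x) := by
    ext x
    simp only [recipGammaProd, hγ]
    congr 1
    refine Finset.prod_congr rfl fun k _ => ?_
    rw [show β k / lam * x = β k * (lam⁻¹ * x) by ring]
  have h1 := (hasAbelBesselMoments_recipGammaProd hα hγ0 hγ1 l).integral_eq m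
    (by simpa using integrableOn_pow_mul_recipGammaProd_mul_besselJ l hα hγ0 hsum one_pos)
  have h2 := integral_comp_mul_left_Ioi
    (fun y => y ^ (2 * m + 1) * recipGammaProd α γ y * besselJ (2 * l) y) 0 hlam
  have h3 : ∀ x : ℝ, (lam * x) ^ (2 * m + 1) * recipGammaProd α γ (lam * x) *
      besselJ (2 * l) (lam * x) = lam ^ (2 * m + 1) *
        (x ^ (2 * m + 1) * recipGammaProd α β x * besselJ (2 * l) (lam * x)) := by
    intro x
    rw [hscale]
    simp only [inv_mul_cancel_left₀ hlam.ne']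
    ring
  simp only [h3, mul_zero] at h2
  rw [integral_const_mul, h1, smul_eq_mul] at h2
  refine mul_left_cancel₀ (pow_ne_zero (2 * m + 1) hlam.ne') (h2.trans ?_)
  rw [Finset.mul_sum, Finset.mul_sum]
  refine Finset.sum_congr rfl fun s _ => ?_
  rw [hscale, iteratedDeriv_comp_const_mul (contDiff_recipGammaProd hα hβ (2 * s)), recipGammaCoeff]
  simp only [mul_zero]
  rw [one_div lam, inv_pow, inv_pow, show 2 * (m + s + 1) = 2 * m + 1 + 2 * s + 1 by ring]
  have := hlam.ne'
  field_simp
  ring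

/-- At equality the rescaled band reaches the branch points `± i`, so the value is obtained as the
limit from larger `λ`, both sides being right-continuous. -/
lemma integral_pow_mul_recipGammaProd_mul_besselJ {M m : ℕ} (l : ℕ) {α β : Fin M → ℝ}
    {lam : ℝ} (hα : ∀ k, 0 < α k) (hβ : ∀ k, 0 < β k)
    (hsum : (m : ℝ) + (1 / 2) * ((M : ℝ) + 3 / 2) < ∑ k, α k) (hlam : 0 < lam)
    (hle : Real.pi * ∑ k, β k ≤ lam) :
    ∫ x in Ioi (0 : ℝ), x ^ (2 * m + 1) * recipGammaProd α β x * besselJ (2 * l) (lam * x) =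
      ∑ s ∈ Finset.range l, (1 / 2) * besselWeight l (m + s) *
        (recipGammaCoeff α β s / (Nat.factorial (2 * s) : ℝ)) * (1 / lam) ^ (2 * (m + s + 1)) := by
  refine tendsto_nhds_unique
    (tendsto_integral_pow_mul_recipGammaProd_mul_besselJ l hα hβ hsum hlam) ?_
  have hc : ContinuousAt (fun r : ℝ => ∑ s ∈ Finset.range l, (1 / 2) * besselWeight l (m + s) *
      (recipGammaCoeff α β s / (Nat.factorial (2 * s) : ℝ)) * (1 / r) ^ (2 * (m + s + 1))) lam := by
    refine tendsto_finsetSum _ fun s _ => ?_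
    have := hlam.ne'
    exact ContinuousAt.mul continuousAt_const ((continuousAt_const.div continuousAt_id this).pow _)
  refine (hc.tendsto.mono_left nhdsWithin_le_nhds).congr' ?_
  filter_upwards [self_mem_nhdsWithin] with r hr
  have hr' : lam < r := hr
  exact (integral_pow_mul_recipGammaProd_mul_besselJ_of_lt l hα hβ hsum (hlam.trans hr')
    (hle.trans_lt hr')).symm

theorem proposition1 (M m l : ℕ) (α β : Fin M → ℝ) (lam : ℝ)
    (hα : ∀ k, 0 < α k) (hβ : ∀ k, 0 < β k)
    (hsum : (m : ℝ) + (1 / 2) * ((M : ℝ) + 3 / 2) < ∑ k, α k)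
    (hlam : Real.pi * ∑ k, β k ≤ lam) :
    IntegrableOn
      (fun x : ℝ => x ^ (2 * m + 1) * recipGammaProd α β x * besselJ (2 * l) (lam * x)) (Ioi 0) ∧
    (m + 1 ≤ l →
      ∫ x in Ioi (0 : ℝ), x ^ (2 * m + 1) * recipGammaProd α β x * besselJ (2 * l) (lam * x) =
        (1 / 2) * ∑ s ∈ Finset.range (l - m),
          recipGammaCoeff α β s / (Nat.factorial (2 * s) : ℝ) *
            ((Nat.factorial (l + m + s) : ℝ) / (Nat.factorial (l - m - s - 1) : ℝ)) *
            (2 / lam) ^ (2 * (m + s + 1))) ∧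
    (l < m + 1 →
      ∫ x in Ioi (0 : ℝ), x ^ (2 * m + 1) * recipGammaProd α β x * besselJ (2 * l) (lam * x) =
        0) := by
  have hlam0 : 0 < lam := by
    refine lt_of_lt_of_le (mul_pos Real.pi_pos ?_) hlam
    -- An empty product is excluded by `hsum`, whose right side would be `0`.
    rcases Nat.eq_zero_or_pos M with rfl | hM
    · exfalso
      have : (0 : ℝ) ≤ m := m.cast_nonneg
      simp only [Finset.univ_eq_empty, Finset.sum_empty, Nat.cast_zero] at hsum
      linarith
    · exact Finset.sum_pos (fun k _ => hβ k) ⟨⟨0, hM⟩, Finset.mem_univ _⟩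
  have hI := integral_pow_mul_recipGammaProd_mul_besselJ l hα hβ hsum hlam0 hlam
  refine ⟨integrableOn_pow_mul_recipGammaProd_mul_besselJ l hα hβ hsum hlam0, fun _ => ?_,
    fun h => ?_⟩
  · rw [hI, Finset.mul_sum]
    symm
    refine (Finset.sum_congr rfl fun s hs => ?_).trans
      -- The terms with `l - m ≤ s < l` have weight zero.
      (Finset.sum_subset (Finset.range_subset_range.2 (Nat.sub_le l m)) fun s _ hs => ?_)
    · have hs' : m + s < l := by have := Finset.mem_range.1 hs; omega
      rw [besselWeight_eq hs', show l + m + s = l + (m + s) by ring,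
        show l - m - s - 1 = l - (m + s) - 1 by omega, div_pow, div_pow,
        show 2 * (m + s + 1) = 2 * (m + s) + 2 by ring]
      ring
    · rw [besselWeight_eq_zero (by have := mt Finset.mem_range.2 hs; omega)]
      simp
  · rw [hI]
    refine Finset.sum_eq_zero fun s _ => ?_
    rw [besselWeight_eq_zero (by omega)]
    simp
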